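/- Let $M\ge 1$ be an integer and $P>0$. For users $k=1,2,\dots$ and transmitters $i=1,2,3$ let $H_{k,i}\in\mathbb{C}^{2M\times M}$ be random channel matrices all of whose entries (over all $k$ and $i$) are i.i.d. circularly symmetric complex Gaussian $\mathcal{CN}(0,1)$. User $k$ uses a postprocessing matrix $F_k\in\mathbb{C}^{M\times 2M}$, $F_kF_k^\dagger=I_M$, which is a (measurable) function of its interfering channels $(H_{k,2},H_{k,3})$ and which minimizes, among all matrices $F$ with $FF^\dagger=I_M$, the rate loss $$\log_2\Big|I_M+\tfrac PM\sum_{i=2}^3FH_{k,i}H_{k,i}^\dagger F^\dagger\Big| .$$ The achievable rate of user $k$ is $$R_k=\log_2\Big|I_M+\tfrac PM F_kH_{k,1}H_{k,1}^\dagger F_k^\dagger\Big(I_M+\tfrac PM\sum_{i=2}^3F_kH_{k,i}H_{k,i}^\dagger F_k^\dagger\Big)^{-1}\Big| .$$ Among the users $1,\dots,K$ one user $k^\star$ is selected, as a (measurable) function of the interfering channels $(H_{k,2},H_{k,3})_{k\le K}$ of these users, by one of the following two opportunistic interference alignment schemes (ties are broken arbitrarily): * OIA1: $k^\star$ minimizes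 $\prod_{m=M+1}^{2M}\big(1+\frac PM\lambda_m(H_{k,2}H_{k,2}^\dagger+H_{k,3}H_{k,3}^\dagger)\big)$ over $k\le K$, where $\lambda_m$ denotes the $m$-th largest eigenvalue; * OIA2: $k^\star$ minimizes the squared chordal distance $M-\mathrm{tr}\big(\tilde H_{k,2}^\dagger\tilde H_{k,3}\tilde H_{k,3}^\dagger\tilde H_{k,2}\big)$ over $k\le K$, where $\tilde H_{k,i}$ is any $2M\times M$ matrix with orthonormal columns and the same column space as $H_{k,i}$ (it exists almost surely). Then for either scheme, with $P$ fixed, the average achievable rate $\mathcal R_{[K]}=\mathbb E[R_{k^\star}]$ of the selected user satisfies $$\lim_{K\to\infty}\mathcal R_{[K]}=\mathbb E\log_2\Big|I_M+\tfrac PM\hat H\hat H^\dagger\Big| ,$$ where $\hat H$ is an $M\times M$ matrix with i.i.d. $\mathcal{CN}(0,1)$ entries; that is, it converges to the ergodic capacity of the interference-free $M\times M$ point-to-point MIMO channel. All these expectations are finite. -/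

import Mathlib

open MeasureTheory ProbabilityTheory Filter Topology
open scoped Matrix

namespace OIA

/-- The law `CN(0, 1)` on `ℂ`: the real and imaginary parts are independent real Gaussians with
mean `0` and variance `1/2`, so that the total variance is `1`. -/
noncomputable def complexGaussian : Measure ℂ :=
  ((gaussianReal 0 (1 / 2)).prod (gaussianReal 0 (1 / 2))).map
    (fun p : ℝ × ℝ => (⟨p.1, p.2⟩ : ℂ))

/-- Channel matrices from a transmitter with `M` antennas to a user with `2 * M` antennas. -/
abbrev Channel (M : ℕ) := Matrix (Fin (2 * M)) (Fin M) ℂ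

/-- Postprocessing matrices. -/
abbrev Post (M : ℕ) := Matrix (Fin M) (Fin (2 * M)) ℂ

/-- The Borel (entrywise product) σ-algebra on matrices. -/
noncomputable instance instMeasurableSpaceMatrix {m n : ℕ} : MeasurableSpace (Matrix (Fin m) (Fin n) ℂ) :=
  (MeasurableSpace.pi : MeasurableSpace (Fin m → Fin n → ℂ))

/-- `H k i` is the random channel matrix from transmitter `i` to user `k` of the first user group
(`i = 0` is the user's own transmitter, `i = 1, 2` are the two interfering ones).  All entries of
all channel matrices are i.i.d. `CN(0, 1)`. -/
structure IsGaussianChannel {Ω : Type*} [MeasurableSpace Ω] {M : ℕ} (μ : Measure Ω)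
    (H : ℕ → Fin 3 → Ω → Channel M) : Prop where
  hasLaw : ∀ (k : ℕ) (i : Fin 3) (r : Fin (2 * M)) (c : Fin M),
    HasLaw (fun ω => H k i ω r c) complexGaussian μ
  indep : iIndepFun
    (fun (j : ℕ × Fin 3 × Fin (2 * M) × Fin M) (ω : Ω) => H j.1 j.2.1 ω j.2.2.1 j.2.2.2) μ

/-- The matrix `I + (P/M) ∑_{i = 2, 3} F Hᵢ Hᵢ† F†`: covariance of noise plus interference after
postprocessing by `F`, where `A` and `B` are the two interfering channels. -/
noncomputable def interferenceCov {M : ℕ} (P : ℝ) (F : Post M) (A B : Channel M) :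
    Matrix (Fin M) (Fin M) ℂ :=
  1 + ((P / M : ℝ) : ℂ) • (F * A * Aᴴ * Fᴴ + F * B * Bᴴ * Fᴴ)

/-- The achievable rate of a user with desired channel `D`, interfering channels `A`, `B` and
postprocessing matrix `F`. -/
noncomputable def rate {M : ℕ} (P : ℝ) (F : Post M) (D A B : Channel M) : ℝ :=
  Real.logb 2 (Matrix.det
    (1 + ((P / M : ℝ) : ℂ) • (F * D * Dᴴ * Fᴴ) * (interferenceCov P F A B)⁻¹)).re

/-- The rate loss term of a user. -/
noncomputable def rateLoss {M : ℕ} (P : ℝ) (F : Post M) (A B : Channel M) : ℝ :=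
  Real.logb 2 (Matrix.det (interferenceCov P F A B)).re

/-- `F k A B` is the postprocessing matrix used by user `k` when its interfering channels are `A`
and `B`: it has orthonormal rows and minimizes the rate loss term among all such matrices. -/
structure IsOIAPostprocessing {M : ℕ} (P : ℝ)
    (F : ℕ → Channel M → Channel M → Post M) : Prop where
  measurable : ∀ k, Measurable (fun p : Channel M × Channel M => F k p.1 p.2)
  semiUnitary : ∀ k A B, F k A B * (F k A B)ᴴ = 1
  minimal : ∀ k A B (F' : Post M), F' * F'ᴴ = 1 → rateLoss P (F k A B) A B ≤ rateLoss P F' A B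

theorem isHermitian_interference {M : ℕ} (A B : Channel M) : (A * Aᴴ + B * Bᴴ).IsHermitian :=
  (Matrix.isHermitian_mul_conjTranspose_self A).add (Matrix.isHermitian_mul_conjTranspose_self B)

/-- The value fed back in the first scheme, `∏_{m = M+1}^{2M} (1 + (P/M) λₘ(A A† + B B†))`, where
`λₘ` is the `m`-th largest eigenvalue (`eigenvalues₀` lists them in decreasing order, starting
from the index `0`). -/
noncomputable def feedback1 {M : ℕ} (P : ℝ) (A B : Channel M) : ℝ :=
  ∏ m : Fin (Fintype.card (Fin (2 * M))),
    if M ≤ (m : ℕ) then 1 + P / M * (isHermitian_interference A B).eigenvalues₀ m else 1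

/-- `A` is a generator matrix of the `M`-dimensional subspace spanned by the columns of `H`. -/
def IsGenerator {M : ℕ} (A H : Channel M) : Prop :=
  Aᴴ * A = 1 ∧ LinearMap.range A.mulVecLin = LinearMap.range H.mulVecLin

/-- The squared chordal distance of the subspaces with generator matrices `A` and `B`. -/
noncomputable def chordalDistSq {M : ℕ} (A B : Channel M) : ℝ :=
  M - (Matrix.trace (Aᴴ * B * Bᴴ * A)).re

/-- A user selection rule: with `K + 1` users, the selected user as a function of the pairs of
interfering channels of all users. -/
abbrev Selection (M : ℕ) := (K : ℕ) → (Fin (K + 1) → Channel M × Channel M) → Fin (K + 1)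

/-- First scheme: the selected user has the smallest fed back eigenvalue product. -/
structure IsOIA1Selection {M : ℕ} (P : ℝ) (sel : Selection M) : Prop where
  measurable : ∀ K, Measurable (sel K)
  minimal : ∀ K (G : Fin (K + 1) → Channel M × Channel M) (k : Fin (K + 1)),
    feedback1 P (G (sel K G)).1 (G (sel K G)).2 ≤ feedback1 P (G k).1 (G k).2

/-- Second scheme: the selected user has the smallest chordal distance between the subspaces
spanned by its two interfering channels, computed from arbitrary generator matrices.  Generator
matrices with `M` columns exist exactly when the channel matrices have full rank `M`. -/
structure IsOIA2Selection {M : ℕ} (sel : Selection M) : Prop where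
  measurable : ∀ K, Measurable (sel K)
  minimal : ∀ K (G T : Fin (K + 1) → Channel M × Channel M),
    (∀ k, IsGenerator (T k).1 (G k).1 ∧ IsGenerator (T k).2 (G k).2) →
    ∀ k : Fin (K + 1),
      chordalDistSq (T (sel K G)).1 (T (sel K G)).2 ≤ chordalDistSq (T k).1 (T k).2

/-- The achievable rate of the selected user among the users `0, …, K`. -/
noncomputable def selectedRate {Ω : Type*} {M : ℕ} (P : ℝ) (H : ℕ → Fin 3 → Ω → Channel M)
    (F : ℕ → Channel M → Channel M → Post M) (sel : Selection M) (K : ℕ) (ω : Ω) : ℝ :=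
  let k : ℕ := sel K (fun j => (H j 1 ω, H j 2 ω))
  rate P (F k (H k 1 ω) (H k 2 ω)) (H k 0 ω) (H k 1 ω) (H k 2 ω)

/-- The law of an `M × M` matrix with i.i.d. `CN(0, 1)` entries. -/
noncomputable def gaussianMatrix (M : ℕ) : Measure (Fin M → Fin M → ℂ) :=
  Measure.pi fun _ => Measure.pi fun _ => complexGaussian

/-- The rate `log₂ |I + (P/M) Ĥ Ĥ†|` of the point-to-point channel `Ĥ`. -/
noncomputable def pointToPointRate {M : ℕ} (P : ℝ) (H : Matrix (Fin M) (Fin M) ℂ) : ℝ :=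
  Real.logb 2 (Matrix.det (1 + ((P / M : ℝ) : ℂ) • (H * Hᴴ))).re

/-- The ergodic capacity of the interference-free `M × M` point-to-point channel. -/
noncomputable def ergodicCapacity (M : ℕ) (P : ℝ) : ℝ :=
  ∫ H, pointToPointRate P (Matrix.of H) ∂(gaussianMatrix M)

end OIA

/-! ### Determinants of positive semidefinite perturbations of the identity. -/

namespace OIA

open scoped ComplexOrder

section Determinants

variable {n : Type*} [Fintype n] [DecidableEq n]

/-! The selection and the postprocessing F depend only on the interfering channels, which are
independent of the desired channels. For fixed interference, F D of the selected user is therefore a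
semi-unitary image of a Gaussian matrix, hence again an i.i.d. Gaussian M × M matrix
(`map_mul_gaussMat`, `measurePreserving_selected`). Monotonicity of the determinant gives, pathwise,
`pointToPointRate` of F D minus the loss ≤ rate ≤ `pointToPointRate` of F D, and also rate ≥ 0. The
upper half bounds the mean rate by the ergodic capacity for every K. The lower half, used where the
loss is at most ε, bounds it below by (1 - Prob(loss > ε)) · capacity - ε. It remains to see that
the loss of the selected user tends to 0 in probability.

By optimality of F the loss is at most log₂ of `feedback1`, and a Courant–Fischer argument with test
space ker A† bounds `feedback1` by the size of B† on that kernel. With many users, with high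
probability some user has both interfering channels close to the same reference matrix [I; 0], so
that they are nearly aligned. Under OIA1 the selected user has a feedback value at least as small.
Under OIA2 only its chordal distance is small, which controls `feedback1` up to a factor ‖B‖². High
moments of the Gaussian entries bound all channels of all users by a small power x of K + 1; with
closeness x⁻² to the reference, the squared distance x⁻⁴ beats the factor x², and `feedback1` is at
most (1 + C/x²)^M, which tends to 1 (`exists_feedback1_selected_le`, `tendsto_feedback1_selected`).
-/

theorem exists_unitary_conj_eq_diagonal {A : Matrix n n ℂ} (hA : A.IsHermitian) :
    ∃ U : Matrix n n ℂ, Uᴴ * U = 1 ∧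
      Uᴴ * A * U = Matrix.diagonal (fun i => (hA.eigenvalues i : ℂ)) := by
  refine ⟨hA.eigenvectorUnitary, Unitary.coe_star_mul_self hA.eigenvectorUnitary, ?_⟩
  have h := hA.conjStarAlgAut_star_eigenvectorUnitary
  rw [Unitary.conjStarAlgAut_star_apply] at h
  exact h

theorem det_one_add_eq_prod {X : Matrix n n ℂ} (hX : X.IsHermitian) :
    (1 + X).det = ((∏ i, (1 + hX.eigenvalues i) : ℝ) : ℂ) := by
  obtain ⟨U, hU, h⟩ := exists_unitary_conj_eq_diagonal hX
  have h1 : Uᴴ * (1 + X) * U = Matrix.diagonal (fun i => ((1 + hX.eigenvalues i : ℝ) : ℂ)) := by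
    rw [mul_add, add_mul, h, mul_one, hU, ← Matrix.diagonal_one, Matrix.diagonal_add]
    simp
  have h2 : Uᴴ.det * U.det = 1 := by rw [← Matrix.det_mul, hU, Matrix.det_one]
  have h3 := congrArg Matrix.det h1
  rw [Matrix.det_mul, Matrix.det_mul, mul_right_comm, h2, one_mul, Matrix.det_diagonal] at h3
  rw [h3]
  simp

theorem one_le_det_one_add {X : Matrix n n ℂ} (hX : X.PosSemidef) : 1 ≤ (1 + X).det.re := by
  rw [det_one_add_eq_prod hX.1, Complex.ofReal_re]
  have h := Finset.prod_le_prod (s := Finset.univ) (f := fun _ : n => (1 : ℝ))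
    (g := fun i => 1 + hX.1.eigenvalues i) (fun _ _ => zero_le_one)
    fun i _ => by linarith [hX.eigenvalues_nonneg i]
  simpa using h

/-- Eigenvalue by eigenvalue, 1 + λ ≤ exp λ. This makes the point-to-point rate integrable, since it
bounds a log-determinant by second moments. -/
theorem det_one_add_le_exp_trace {X : Matrix n n ℂ} (hX : X.PosSemidef) :
    (1 + X).det.re ≤ Real.exp X.trace.re := by
  rw [det_one_add_eq_prod hX.1, Complex.ofReal_re, hX.1.trace_eq_sum_eigenvalues]
  have : (∑ i, ((hX.1.eigenvalues i : ℝ) : ℂ)).re = ∑ i, hX.1.eigenvalues i := by simp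
  erw [this]
  rw [Real.exp_sum]
  refine Finset.prod_le_prod (fun i _ => by linarith [hX.eigenvalues_nonneg i]) fun i _ => ?_
  linarith [Real.add_one_le_exp (hX.1.eigenvalues i)]

theorem exists_conjTranspose_mul_mul_eq_one {A : Matrix n n ℂ} (hA : A.PosDef) :
    ∃ W : Matrix n n ℂ, Wᴴ * A * W = 1 := by
  obtain ⟨U, hU, h⟩ := exists_unitary_conj_eq_diagonal hA.1
  refine ⟨U * Matrix.diagonal (fun i => (((Real.sqrt (hA.1.eigenvalues i))⁻¹ : ℝ) : ℂ)), ?_⟩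
  rw [Matrix.conjTranspose_mul, Matrix.diagonal_conjTranspose]
  have h2 (D E : Matrix n n ℂ) : D * Uᴴ * A * (U * E) = D * (Uᴴ * A * U) * E := by
    simp only [mul_assoc]
  rw [h2, h, Matrix.diagonal_mul_diagonal, Matrix.diagonal_mul_diagonal, ← Matrix.diagonal_one]
  congr 1
  funext i
  have hp := hA.eigenvalues_pos i
  have hs : Real.sqrt (hA.1.eigenvalues i) ≠ 0 := (Real.sqrt_pos.2 hp).ne'
  have h3 : (Real.sqrt (hA.1.eigenvalues i))⁻¹ * hA.1.eigenvalues i *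
      (Real.sqrt (hA.1.eigenvalues i))⁻¹ = 1 := by
    nth_rewrite 2 [← Real.mul_self_sqrt hp.le]
    field_simp
  simp only [Pi.star_apply, RCLike.star_def, Complex.conj_ofReal]
  exact_mod_cast h3

/-- A congruence by W turns A into the identity and multiplies both determinants by |det W|², so the
claim reduces to `one_le_det_one_add` for Wᴴ C W. -/
theorem det_le_det_add {A C : Matrix n n ℂ} (hA : A.PosDef) (hC : C.PosSemidef) :
    A.det.re ≤ (A + C).det.re := by
  obtain ⟨W, hW⟩ := exists_conjTranspose_mul_mul_eq_one hA
  have h1 := one_le_det_one_add (hC.conjTranspose_mul_mul_same W)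
  have key (X : Matrix n n ℂ) :
      (Wᴴ * X * W).det.re = Complex.normSq W.det * X.det.re := by
    rw [Matrix.det_mul, Matrix.det_mul, Matrix.det_conjTranspose, mul_right_comm,
      RCLike.star_def, ← Complex.normSq_eq_conj_mul_self, Complex.re_ofReal_mul]
  have h2 : Wᴴ * (A + C) * W = 1 + Wᴴ * C * W := by rw [mul_add, add_mul, hW]
  rw [← h2, key] at h1
  have h3 := key A
  rw [hW, Matrix.det_one, Complex.one_re] at h3
  have h4 : 0 < Complex.normSq W.det := by
    rcases (Complex.normSq_nonneg W.det).lt_or_eq with h | h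
    · exact h
    · rw [← h] at h3; simp at h3
  nlinarith

theorem posSemidef_one_sub_inv {S : Matrix n n ℂ} (hS : S.PosSemidef) :
    (1 - (1 + S)⁻¹).PosSemidef := by
  have hP : (1 + S).PosDef := Matrix.PosDef.one.add_posSemidef hS
  have hu : IsUnit (1 + S).det := (Matrix.isUnit_iff_isUnit_det _).1 hP.isUnit
  have h : 1 - (1 + S)⁻¹ = (1 + S)⁻¹ * (S + S * Sᴴ) * ((1 + S)⁻¹)ᴴ := by
    rw [hP.inv.1.eq, hS.1.eq]
    have h1 : S + S * S = (1 + S) * (1 + S) - (1 + S) := by noncomm_ring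
    rw [h1, mul_sub, sub_mul, Matrix.nonsing_inv_mul _ hu, ← mul_assoc,
      Matrix.nonsing_inv_mul _ hu, one_mul, one_mul, Matrix.mul_nonsing_inv _ hu]
  rw [h]
  exact (hS.add (Matrix.posSemidef_self_mul_conjTranspose S)).mul_mul_conjTranspose_same _

variable {m : Type*} [Fintype m] [DecidableEq m]

/-- The product Y Yᴴ (1 + S)⁻¹ need not be Hermitian; Sylvester's identity replaces it by the
positive semidefinite Yᴴ (1 + S)⁻¹ Y with the same determinant. -/
theorem one_le_det_one_add_mul_inv {S : Matrix n n ℂ} (hS : S.PosSemidef) (Y : Matrix n m ℂ) :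
    1 ≤ (1 + Y * Yᴴ * (1 + S)⁻¹).det.re := by
  have hP : (1 + S).PosDef := Matrix.PosDef.one.add_posSemidef hS
  rw [Matrix.mul_assoc, Matrix.det_one_add_mul_comm]
  exact one_le_det_one_add (hP.inv.posSemidef.conjTranspose_mul_mul_same Y)

/-- After Sylvester's identity the two sides differ by Yᴴ (1 - (1 + S)⁻¹) Y inside the determinant,
which is positive semidefinite. -/
theorem det_one_add_mul_inv_le {S : Matrix n n ℂ} (hS : S.PosSemidef) (Y : Matrix n m ℂ) :
    (1 + Y * Yᴴ * (1 + S)⁻¹).det.re ≤ (1 + Y * Yᴴ).det.re := by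
  have hP : (1 + S).PosDef := Matrix.PosDef.one.add_posSemidef hS
  rw [Matrix.mul_assoc, Matrix.det_one_add_mul_comm, Matrix.det_one_add_mul_comm Y Yᴴ]
  have h : 1 + Yᴴ * Y = 1 + Yᴴ * (1 + S)⁻¹ * Y + Yᴴ * (1 - (1 + S)⁻¹) * Y := by
    rw [Matrix.mul_sub, Matrix.sub_mul, Matrix.mul_one]
    abel
  rw [h]
  exact det_le_det_add
    (Matrix.PosDef.one.add_posSemidef (hP.inv.posSemidef.conjTranspose_mul_mul_same Y))
    ((posSemidef_one_sub_inv hS).conjTranspose_mul_mul_same Y)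

theorem det_one_add_mul_inv_eq {S : Matrix n n ℂ} (hS : S.PosSemidef) {X : Matrix n n ℂ} :
    (1 + X * (1 + S)⁻¹).det.re = (1 + S + X).det.re / (1 + S).det.re := by
  have hP : (1 + S).PosDef := Matrix.PosDef.one.add_posSemidef hS
  have hu : IsUnit (1 + S).det := (Matrix.isUnit_iff_isUnit_det _).1 hP.isUnit
  have h : (1 + X * (1 + S)⁻¹) * (1 + S) = 1 + S + X := by
    rw [add_mul, one_mul, mul_assoc, Matrix.nonsing_inv_mul _ hu, mul_one]
  have h1 := one_le_det_one_add hS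
  -- The determinant of 1 + S is real, so the real part of the product factors.
  have h2 : (1 + S).det = (((1 + S).det.re : ℝ) : ℂ) := by
    rw [det_one_add_eq_prod hS.1, Complex.ofReal_re]
  have h3 := congrArg Matrix.det h
  rw [Matrix.det_mul, h2] at h3
  have h4 := congrArg Complex.re h3
  rw [mul_comm, Complex.re_ofReal_mul] at h4
  rw [eq_div_iff (by linarith), ← h4, mul_comm]

end Determinants

/-! ### Pathwise bounds on the rate. -/

theorem gram_smul_eq {m n : Type*} [Fintype n] {c : ℝ} (hc : 0 ≤ c) (Y : Matrix m n ℂ) :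
    (c : ℂ) • (Y * Yᴴ) = (((√c : ℝ) : ℂ) • Y) * (((√c : ℝ) : ℂ) • Y)ᴴ := by
  rw [Matrix.conjTranspose_smul, Matrix.smul_mul, Matrix.mul_smul, smul_smul]
  congr 1
  rw [RCLike.star_def, Complex.conj_ofReal, ← Complex.ofReal_mul, Real.mul_self_sqrt hc]

theorem posSemidef_smul_gram {m n : Type*} [Fintype m] [Fintype n] {c : ℝ} (hc : 0 ≤ c)
    (Y : Matrix m n ℂ) : ((c : ℂ) • (Y * Yᴴ)).PosSemidef := by
  rw [gram_smul_eq hc]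
  exact Matrix.posSemidef_self_mul_conjTranspose _

variable {M : ℕ} {P : ℝ}

/-- The postprocessed interference `(P/M) ∑ F Hᵢ Hᵢ† F†`. -/
noncomputable def interference (P : ℝ) (F : Post M) (A B : Channel M) : Matrix (Fin M) (Fin M) ℂ :=
  ((P / M : ℝ) : ℂ) • (F * A * Aᴴ * Fᴴ + F * B * Bᴴ * Fᴴ)

theorem interferenceCov_eq (F : Post M) (A B : Channel M) :
    interferenceCov P F A B = 1 + interference P F A B := rfl

theorem posSemidef_interference (hP : 0 ≤ P) (F : Post M) (A B : Channel M) :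
    (interference P F A B).PosSemidef := by
  have hc : 0 ≤ P / M := div_nonneg hP (Nat.cast_nonneg M)
  have h (X : Channel M) : F * X * Xᴴ * Fᴴ = (F * X) * (F * X)ᴴ := by
    rw [Matrix.conjTranspose_mul, ← Matrix.mul_assoc]
  rw [interference, h, h, smul_add]
  exact (posSemidef_smul_gram hc _).add (posSemidef_smul_gram hc _)

theorem rate_eq (F : Post M) (D A B : Channel M) :
    rate P F D A B = Real.logb 2 (Matrix.det (1 + ((P / M : ℝ) : ℂ) • ((F * D) * (F * D)ᴴ) *
      (1 + interference P F A B)⁻¹)).re := by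
  rw [rate, interferenceCov_eq, Matrix.conjTranspose_mul, ← Matrix.mul_assoc]

theorem rate_eq_sub (hP : 0 ≤ P) (F : Post M) (D A B : Channel M) :
    rate P F D A B = Real.logb 2 (interferenceCov P F A B +
      ((P / M : ℝ) : ℂ) • ((F * D) * (F * D)ᴴ)).det.re - rateLoss P F A B := by
  have hS := posSemidef_interference hP F A B
  have hX := posSemidef_smul_gram (div_nonneg hP (Nat.cast_nonneg M)) (F * D)
  have h1 := one_le_det_one_add hS
  have h2 := one_le_det_one_add (hS.add hX)
  rw [rate_eq, det_one_add_mul_inv_eq hS, rateLoss, interferenceCov_eq,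
    Real.logb_div (by rw [add_assoc]; linarith) (by linarith)]

theorem rate_nonneg (hP : 0 ≤ P) (F : Post M) (D A B : Channel M) : 0 ≤ rate P F D A B := by
  rw [rate_eq, gram_smul_eq (div_nonneg hP (Nat.cast_nonneg M))]
  exact Real.logb_nonneg one_lt_two
    (one_le_det_one_add_mul_inv (posSemidef_interference hP F A B) _)

theorem rate_le_pointToPointRate (hP : 0 ≤ P) (F : Post M) (D A B : Channel M) :
    rate P F D A B ≤ pointToPointRate P (F * D) := by
  rw [rate_eq, pointToPointRate, gram_smul_eq (div_nonneg hP (Nat.cast_nonneg M))]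
  have hS := posSemidef_interference hP F A B
  exact Real.logb_le_logb_of_le one_lt_two
    (zero_lt_one.trans_le (one_le_det_one_add_mul_inv hS _)) (det_one_add_mul_inv_le hS _)

/-- Writing the rate as a difference of log-determinants, dropping the interference from the first
one can only decrease it. -/
theorem pointToPointRate_sub_rateLoss_le (hP : 0 ≤ P) (F : Post M) (D A B : Channel M) :
    pointToPointRate P (F * D) - rateLoss P F A B ≤ rate P F D A B := by
  rw [rate_eq_sub hP, pointToPointRate]
  have hS := posSemidef_interference hP F A B
  have hX := posSemidef_smul_gram (div_nonneg hP (Nat.cast_nonneg M)) (F * D)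
  have h : interferenceCov P F A B + ((P / M : ℝ) : ℂ) • ((F * D) * (F * D)ᴴ) =
      1 + ((P / M : ℝ) : ℂ) • ((F * D) * (F * D)ᴴ) + interference P F A B := by
    rw [interferenceCov_eq]; abel
  rw [h]
  refine sub_le_sub_right (Real.logb_le_logb_of_le one_lt_two
    (zero_lt_one.trans_le (one_le_det_one_add hX)) ?_) _
  exact det_le_det_add (Matrix.PosDef.one.add_posSemidef hX) hS

theorem pointToPointRate_nonneg (hP : 0 ≤ P) (X : Matrix (Fin M) (Fin M) ℂ) :
    0 ≤ pointToPointRate P X :=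
  Real.logb_nonneg one_lt_two
    (one_le_det_one_add (posSemidef_smul_gram (div_nonneg hP (Nat.cast_nonneg M)) X))

theorem trace_mul_conjTranspose_re {m n : Type*} [Fintype m] [Fintype n] (X : Matrix m n ℂ) :
    (X * Xᴴ).trace.re = ∑ i, ∑ j, ‖X i j‖ ^ 2 := by
  simp [Matrix.trace, Matrix.mul_apply, Complex.mul_conj, Complex.normSq_eq_norm_sq]
  norm_cast

theorem pointToPointRate_le (hP : 0 ≤ P) (X : Matrix (Fin M) (Fin M) ℂ) :
    pointToPointRate P X ≤ P / M * (∑ i, ∑ j, ‖X i j‖ ^ 2) / Real.log 2 := by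
  have hX := posSemidef_smul_gram (div_nonneg hP (Nat.cast_nonneg M)) X
  have h1 := one_le_det_one_add hX
  have h2 := det_one_add_le_exp_trace hX
  rw [Matrix.trace_smul, smul_eq_mul, Complex.re_ofReal_mul, trace_mul_conjTranspose_re] at h2
  rw [pointToPointRate, Real.logb]
  gcongr
  exact (Real.log_le_iff_le_exp (by linarith)).2 h2

end OIA

/-! ### The rate loss and the smallest eigenvalues of the interference. -/

namespace OIA

open scoped ComplexOrder

section QuadraticForms

variable {m n : Type*} [Fintype m] [Fintype n]

theorem star_dotProduct_self (v : n → ℂ) : star v ⬝ᵥ v = ((∑ i, ‖v i‖ ^ 2 : ℝ) : ℂ) := by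
  simp [dotProduct, Complex.conj_mul']

theorem star_dotProduct_gram_mulVec (A : Matrix m n ℂ) (x : m → ℂ) :
    star x ⬝ᵥ ((A * Aᴴ) *ᵥ x) = ((∑ i, ‖(Aᴴ *ᵥ x) i‖ ^ 2 : ℝ) : ℂ) := by
  rw [← star_dotProduct_self, Matrix.star_mulVec, Matrix.conjTranspose_conjTranspose,
    ← Matrix.mulVec_mulVec, Matrix.dotProduct_mulVec]

theorem exists_ne_zero_mulVec_eq_zero (h : Fintype.card m < Fintype.card n) (A : Matrix m n ℂ) :
    ∃ v : n → ℂ, v ≠ 0 ∧ A *ᵥ v = 0 := by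
  have h1 : LinearMap.ker A.mulVecLin ≠ ⊥ := LinearMap.ker_ne_bot_of_finrank_lt (by simpa using h)
  obtain ⟨v, hv, hv0⟩ := Submodule.exists_mem_ne_zero_of_ne_bot h1
  exact ⟨v, hv0, by simpa using hv⟩

end QuadraticForms

variable {M : ℕ} {P : ℝ}

/-- The `(M + j + 1)`-st largest eigenvalue of `A A† + B B†`. -/
noncomputable def lowerEigenvalue (A B : Channel M) (j : Fin M) : ℝ :=
  (isHermitian_interference A B).eigenvalues₀
    ⟨M + j, by rw [Fintype.card_fin]; omega⟩

theorem feedback1_eq (A B : Channel M) :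
    feedback1 P A B = ∏ j, (1 + P / M * lowerEigenvalue A B j) := by
  have hN : M + M = Fintype.card (Fin (2 * M)) := by rw [Fintype.card_fin]; omega
  rw [feedback1, ← (finCongr hN).prod_comp, Fin.prod_univ_add]
  have h1 : ∀ i : Fin M, ¬ M ≤ ((finCongr hN) (Fin.castAdd M i) : ℕ) := fun i => by simp
  have h2 : ∀ i : Fin M, M ≤ ((finCongr hN) (Fin.natAdd M i) : ℕ) := fun i => by simp
  simp only [if_neg (h1 _), if_pos (h2 _), Finset.prod_const_one, one_mul]
  rfl

theorem posSemidef_gram_add (A B : Channel M) : (A * Aᴴ + B * Bᴴ).PosSemidef :=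
  (Matrix.posSemidef_self_mul_conjTranspose A).add (Matrix.posSemidef_self_mul_conjTranspose B)

theorem lowerEigenvalue_nonneg (A B : Channel M) (j : Fin M) : 0 ≤ lowerEigenvalue A B j := by
  have h := (posSemidef_gram_add A B).eigenvalues_nonneg
    (Fintype.equivOfCardEq (Fintype.card_fin _) ⟨M + j, by rw [Fintype.card_fin]; omega⟩)
  rw [Matrix.IsHermitian.eigenvalues, Equiv.symm_apply_apply] at h
  exact h

theorem one_le_feedback1 (hP : 0 ≤ P) (A B : Channel M) : 1 ≤ feedback1 P A B := by
  have hc : 0 ≤ P / M := div_nonneg hP (Nat.cast_nonneg M)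
  rw [feedback1_eq]
  have h := Finset.prod_le_prod (s := Finset.univ) (f := fun _ : Fin M => (1 : ℝ))
    (g := fun j => 1 + P / M * lowerEigenvalue A B j) (fun _ _ => zero_le_one)
    fun j _ => by linarith [mul_nonneg hc (lowerEigenvalue_nonneg A B j)]
  simpa using h

/-- Postprocessing by the eigenvectors of the `M` smallest eigenvalues attains the first feedback
value. -/
theorem exists_post_rateLoss_eq (A B : Channel M) :
    ∃ F : Post M, F * Fᴴ = 1 ∧ rateLoss P F A B = Real.logb 2 (feedback1 P A B) := by
  obtain ⟨U, hU, hdiag⟩ := exists_unitary_conj_eq_diagonal (isHermitian_interference A B)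
  -- `eigenvalues` is `eigenvalues₀` reindexed along this equivalence, so positions in the
  -- decreasing order are transported through it.
  let e : Fin (Fintype.card (Fin (2 * M))) ≃ Fin (2 * M) :=
    Fintype.equivOfCardEq (Fintype.card_fin _)
  let κ : Fin M → Fin (2 * M) := fun j => e ⟨M + j, by rw [Fintype.card_fin]; omega⟩
  have hκ : Function.Injective κ := fun i j hij => by
    have := e.injective hij
    rw [Fin.mk.injEq] at this
    exact Fin.ext (by omega)
  let F : Post M := Uᴴ.submatrix κ id
  have hFc : Fᴴ = U.submatrix id κ := by
    simp [F, Matrix.conjTranspose_submatrix]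
  refine ⟨F, ?_, ?_⟩
  · rw [hFc]
    change Uᴴ.submatrix κ id * U.submatrix id κ = 1
    rw [← Matrix.submatrix_mul _ _ _ _ _ Function.bijective_id, hU, Matrix.submatrix_one _ hκ]
  · have h1 : F * A * Aᴴ * Fᴴ + F * B * Bᴴ * Fᴴ =
        Matrix.diagonal (fun j => (lowerEigenvalue A B j : ℂ)) := by
      have h2 : F * A * Aᴴ * Fᴴ + F * B * Bᴴ * Fᴴ = F * (A * Aᴴ + B * Bᴴ) * Fᴴ := by
        simp only [Matrix.mul_add, Matrix.add_mul, Matrix.mul_assoc]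
      have h3 : F * (A * Aᴴ + B * Bᴴ) * Fᴴ =
          (Uᴴ * (A * Aᴴ + B * Bᴴ) * U).submatrix κ κ := by
        rw [Matrix.submatrix_mul _ _ κ id κ Function.bijective_id,
          Matrix.submatrix_mul _ _ κ id id Function.bijective_id, hFc, Matrix.submatrix_id_id]
      rw [h2, h3, hdiag, Matrix.submatrix_diagonal _ _ hκ]
      congr 1
      funext j
      simp only [Function.comp, Matrix.IsHermitian.eigenvalues, κ, e, Equiv.symm_apply_apply]
      rfl
    rw [rateLoss, interferenceCov, h1, feedback1_eq]
    congr 1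
    have h4 : (1 : Matrix (Fin M) (Fin M) ℂ) +
        ((P / M : ℝ) : ℂ) • Matrix.diagonal (fun j => (lowerEigenvalue A B j : ℂ)) =
        Matrix.diagonal (fun j => ((1 + P / M * lowerEigenvalue A B j : ℝ) : ℂ)) := by
      rw [← Matrix.diagonal_one, ← Matrix.diagonal_smul, Matrix.diagonal_add]
      congr 1
      funext j
      simp
    rw [h4, Matrix.det_diagonal, ← Complex.ofReal_prod, Complex.ofReal_re]

/-- From here on F enters the loss estimate only through this bound. -/
theorem IsOIAPostprocessing.rateLoss_le {F : ℕ → Channel M → Channel M → Post M}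
    (hF : IsOIAPostprocessing P F) (k : ℕ) (A B : Channel M) :
    rateLoss P (F k A B) A B ≤ Real.logb 2 (feedback1 P A B) := by
  obtain ⟨F', h1, h2⟩ := exists_post_rateLoss_eq (P := P) A B
  exact h2 ▸ hF.minimal k A B F' h1

/-- One half of the Courant–Fischer principle for the test space `ker A†`. -/
theorem lowerEigenvalue_le {A B : Channel M} {s : ℝ}
    (hs : ∀ x, Aᴴ *ᵥ x = 0 → ∑ i, ‖(Bᴴ *ᵥ x) i‖ ^ 2 ≤ s * ∑ i, ‖x i‖ ^ 2) (j : Fin M) :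
    lowerEigenvalue A B j ≤ s := by
  obtain ⟨U, hU, hdiag⟩ := exists_unitary_conj_eq_diagonal (isHermitian_interference A B)
  let e : Fin (Fintype.card (Fin (2 * M))) ≃ Fin (2 * M) :=
    Fintype.equivOfCardEq (Fintype.card_fin _)
  -- The existence of j forces M ≥ 1, so there are M + 1 ≤ 2M leading eigenvectors.
  have hj := j.isLt
  have hlt (i : Fin (M + 1)) : (i : ℕ) < Fintype.card (Fin (2 * M)) := by
    rw [Fintype.card_fin]; omega
  let κ : Fin (M + 1) → Fin (2 * M) := fun i => e ⟨i, hlt i⟩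
  have hκ : Function.Injective κ := fun a b hab => by
    have := e.injective hab
    rw [Fin.mk.injEq] at this
    exact Fin.ext this
  let V : Matrix (Fin (2 * M)) (Fin (M + 1)) ℂ := U.submatrix id κ
  have hVc : Vᴴ = Uᴴ.submatrix κ id := by simp [V, Matrix.conjTranspose_submatrix]
  let l : Fin (M + 1) → ℝ := fun i => (isHermitian_interference A B).eigenvalues (κ i)
  have hV1 : Vᴴ * V = 1 := by
    rw [hVc]
    change Uᴴ.submatrix κ id * U.submatrix id κ = 1
    rw [← Matrix.submatrix_mul _ _ _ _ _ Function.bijective_id, hU, Matrix.submatrix_one _ hκ]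
  have hV2 : Vᴴ * (A * Aᴴ + B * Bᴴ) * V = Matrix.diagonal (fun i => (l i : ℂ)) := by
    have h3 : Vᴴ * (A * Aᴴ + B * Bᴴ) * V = (Uᴴ * (A * Aᴴ + B * Bᴴ) * U).submatrix κ κ := by
      rw [Matrix.submatrix_mul _ _ κ id κ Function.bijective_id,
        Matrix.submatrix_mul _ _ κ id id Function.bijective_id, hVc, Matrix.submatrix_id_id]
    rw [h3, hdiag, Matrix.submatrix_diagonal _ _ hκ]
    rfl
  -- Dimension count: Aᴴ V is M × (M + 1), so the span of the M + 1 leading eigenvectors meets ker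
  -- Aᴴ nontrivially. All eigenvalues on that span dominate the one indexed by j.
  obtain ⟨a, ha, ha0⟩ := exists_ne_zero_mulVec_eq_zero (by simp) (Aᴴ * V)
  rw [← Matrix.mulVec_mulVec] at ha0
  have hx := hs _ ha0
  have hnorm : ∑ i, ‖(V *ᵥ a) i‖ ^ 2 = ∑ i, ‖a i‖ ^ 2 := by
    have h5 := star_dotProduct_self (V *ᵥ a)
    rw [Matrix.star_mulVec, ← Matrix.dotProduct_mulVec, Matrix.mulVec_mulVec, hV1,
      Matrix.one_mulVec, star_dotProduct_self] at h5
    exact_mod_cast h5.symm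
  have hquad : ∑ i, ‖(Bᴴ *ᵥ (V *ᵥ a)) i‖ ^ 2 = ∑ i, l i * ‖a i‖ ^ 2 := by
    have h5 : star (V *ᵥ a) ⬝ᵥ ((A * Aᴴ + B * Bᴴ) *ᵥ (V *ᵥ a)) =
        ((∑ i, l i * ‖a i‖ ^ 2 : ℝ) : ℂ) := by
      rw [Matrix.star_mulVec, ← Matrix.dotProduct_mulVec, Matrix.mulVec_mulVec,
        Matrix.mulVec_mulVec, hV2]
      simp only [dotProduct, Matrix.mulVec_diagonal, Pi.star_apply, RCLike.star_def]
      push_cast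
      refine Finset.sum_congr rfl fun i _ => ?_
      rw [← Complex.conj_mul']
      ring
    rw [Matrix.add_mulVec, dotProduct_add, star_dotProduct_gram_mulVec,
      star_dotProduct_gram_mulVec, ha0] at h5
    simp only [Pi.zero_apply, norm_zero] at h5
    have h6 : ((∑ i, ‖(Bᴴ *ᵥ (V *ᵥ a)) i‖ ^ 2 : ℝ) : ℂ) = ((∑ i, l i * ‖a i‖ ^ 2 : ℝ) : ℂ) := by
      simpa using h5
    exact_mod_cast h6
  have hl (i : Fin (M + 1)) : lowerEigenvalue A B j ≤ l i := by
    simp only [l, κ, e, Matrix.IsHermitian.eigenvalues, Equiv.symm_apply_apply]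
    refine (isHermitian_interference A B).eigenvalues₀_antitone ?_
    rw [Fin.mk_le_mk]
    omega
  have hpos : 0 < ∑ i, ‖a i‖ ^ 2 := by
    obtain ⟨i, hi⟩ := Function.ne_iff.1 ha
    exact Finset.sum_pos' (fun _ _ => sq_nonneg _)
      ⟨i, Finset.mem_univ _, by have : 0 < ‖a i‖ := norm_pos_iff.2 hi; positivity⟩
  rw [hquad, hnorm] at hx
  have h7 : lowerEigenvalue A B j * ∑ i, ‖a i‖ ^ 2 ≤ ∑ i, l i * ‖a i‖ ^ 2 := by
    rw [Finset.mul_sum]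
    exact Finset.sum_le_sum fun i _ => mul_le_mul_of_nonneg_right (hl i) (sq_nonneg _)
  exact le_of_mul_le_mul_right (h7.trans hx) hpos

theorem feedback1_le (hP : 0 ≤ P) {A B : Channel M} {s : ℝ}
    (hs : ∀ x, Aᴴ *ᵥ x = 0 → ∑ i, ‖(Bᴴ *ᵥ x) i‖ ^ 2 ≤ s * ∑ i, ‖x i‖ ^ 2) :
    feedback1 P A B ≤ (1 + P / M * s) ^ M := by
  have hc : 0 ≤ P / M := div_nonneg hP (Nat.cast_nonneg M)
  rw [feedback1_eq]
  refine (Finset.prod_le_prod (g := fun _ => 1 + P / M * s) (fun j _ => ?_) fun j _ => ?_).trans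
    (by simp)
  · linarith [mul_nonneg hc (lowerEigenvalue_nonneg A B j)]
  · linarith [mul_le_mul_of_nonneg_left (lowerEigenvalue_le hs j) hc]

end OIA

/-! ### Frobenius norm, chordal distance and alignment. -/

namespace OIA

open scoped ComplexOrder

section Frobenius

variable {l m n : Type*} [Fintype l] [Fintype m] [Fintype n]

/-- The squared Frobenius norm. -/
noncomputable def frobSq (X : Matrix m n ℂ) : ℝ := ∑ i, ∑ j, ‖X i j‖ ^ 2

theorem frobSq_nonneg (X : Matrix m n ℂ) : 0 ≤ frobSq X :=
  Finset.sum_nonneg fun _ _ => Finset.sum_nonneg fun _ _ => sq_nonneg _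

theorem frobSq_conjTranspose (X : Matrix m n ℂ) : frobSq Xᴴ = frobSq X := by
  rw [frobSq, Finset.sum_comm]
  simp [frobSq]

theorem frobSq_eq_trace (X : Matrix m n ℂ) : frobSq X = (Xᴴ * X).trace.re := by
  have h := trace_mul_conjTranspose_re Xᴴ
  rw [Matrix.conjTranspose_conjTranspose] at h
  rw [h, ← frobSq_conjTranspose, frobSq]

theorem sum_norm_sq_mulVec_le (X : Matrix m n ℂ) (v : n → ℂ) :
    ∑ i, ‖(X *ᵥ v) i‖ ^ 2 ≤ frobSq X * ∑ j, ‖v j‖ ^ 2 := by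
  rw [frobSq, Finset.sum_mul]
  refine Finset.sum_le_sum fun i _ => ?_
  refine le_trans ?_ (Finset.sum_mul_sq_le_sq_mul_sq _ (fun j => ‖X i j‖) fun j => ‖v j‖)
  gcongr
  refine (norm_sum_le _ _).trans_eq ?_
  simp

theorem frobSq_mul_le (X : Matrix l m ℂ) (Y : Matrix m n ℂ) :
    frobSq (X * Y) ≤ frobSq X * frobSq Y := by
  have h1 : frobSq (X * Y) = ∑ j, ∑ i, ‖(X *ᵥ fun k => Y k j) i‖ ^ 2 := by
    rw [frobSq, Finset.sum_comm]
    rfl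
  have h2 : frobSq Y = ∑ j, ∑ k, ‖Y k j‖ ^ 2 := by rw [frobSq, Finset.sum_comm]
  rw [h1, h2, Finset.mul_sum]
  exact Finset.sum_le_sum fun j _ => sum_norm_sq_mulVec_le X _

theorem frobSq_sub_le (X Y : Matrix m n ℂ) : frobSq (X - Y) ≤ 2 * frobSq X + 2 * frobSq Y := by
  simp only [frobSq, Finset.mul_sum, ← Finset.sum_add_distrib]
  refine Finset.sum_le_sum fun i _ => Finset.sum_le_sum fun j _ => ?_
  have h := norm_sub_le (X i j) (Y i j)
  rw [Matrix.sub_apply]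
  nlinarith [norm_nonneg (X i j - Y i j), sq_nonneg (‖X i j‖ - ‖Y i j‖)]

theorem frobSq_le_of_norm_le {X : Matrix m n ℂ} {t : ℝ} (h : ∀ i j, ‖X i j‖ ≤ t) :
    frobSq X ≤ Fintype.card m * Fintype.card n * t ^ 2 := by
  have h1 : frobSq X ≤ ∑ _i : m, ∑ _j : n, t ^ 2 :=
    Finset.sum_le_sum fun i _ => Finset.sum_le_sum fun j _ =>
      pow_le_pow_left₀ (norm_nonneg _) (h i j) 2
  simpa [mul_assoc] using h1

theorem frobSq_of_isometry [DecidableEq n] {X : Matrix m n ℂ} (h : Xᴴ * X = 1) :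
    frobSq X = Fintype.card n := by
  rw [frobSq_eq_trace, h, Matrix.trace_one]
  simp

end Frobenius

section Range

variable {l m n : Type*} [Fintype l] [Fintype n]

theorem exists_eq_mul_of_range_le [DecidableEq n] {X : Matrix m n ℂ} {Y : Matrix m l ℂ}
    (h : LinearMap.range X.mulVecLin ≤ LinearMap.range Y.mulVecLin) : ∃ S : Matrix l n ℂ, X = Y * S := by
  have h1 (j : n) : ∃ v, Y *ᵥ v = X *ᵥ Pi.single j 1 := by
    have h2 : X *ᵥ Pi.single j 1 ∈ LinearMap.range Y.mulVecLin := h ⟨_, rfl⟩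
    exact h2
  choose v hv using h1
  refine ⟨Matrix.of fun k j => v j k, ?_⟩
  ext i j
  have h3 := congrFun (hv j) i
  rw [Matrix.mulVec_single_one] at h3
  exact h3.symm

theorem range_mul_le [DecidableEq n] (X : Matrix m l ℂ) (S : Matrix l n ℂ) :
    LinearMap.range (X * S).mulVecLin ≤ LinearMap.range X.mulVecLin := by
  rw [Matrix.mulVecLin_mul]
  exact LinearMap.range_comp_le_range _ _

end Range

variable {M : ℕ} {P : ℝ}

/-- On ker Aᴴ the maps Bᴴ and (B - A)ᴴ coincide. -/
theorem feedback1_le_frobSq_sub (hP : 0 ≤ P) (A B : Channel M) :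
    feedback1 P A B ≤ (1 + P / M * frobSq (B - A)) ^ M := by
  refine feedback1_le hP fun x hx => ?_
  have h : Bᴴ *ᵥ x = (B - A)ᴴ *ᵥ x := by
    rw [Matrix.conjTranspose_sub, Matrix.sub_mulVec, hx, sub_zero]
  rw [h, ← frobSq_conjTranspose]
  exact sum_norm_sq_mulVec_le _ x

theorem exists_isGenerator {H : Channel M} (hH : (Hᴴ * H).PosDef) : ∃ A, IsGenerator A H := by
  obtain ⟨W, hW⟩ := exists_conjTranspose_mul_mul_eq_one hH
  refine ⟨H * W, ?_, le_antisymm (range_mul_le H W) ?_⟩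
  · rw [Matrix.conjTranspose_mul, Matrix.mul_assoc, ← Matrix.mul_assoc Hᴴ, ← Matrix.mul_assoc, hW]
  · have h1 : W * (Wᴴ * (Hᴴ * H)) = 1 := mul_eq_one_comm.1 hW
    have h2 : H = (H * W) * (Wᴴ * (Hᴴ * H)) := by
      rw [Matrix.mul_assoc H, h1, Matrix.mul_one]
    conv_lhs => rw [h2]
    exact range_mul_le _ _

/-- The squared chordal distance is the squared Frobenius norm of the part of one generator
orthogonal to the other subspace. -/
theorem chordalDistSq_eq_frobSq {A B : Channel M} (hA : Aᴴ * A = 1) (hB : Bᴴ * B = 1) :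
    chordalDistSq A B = frobSq (A - B * (Bᴴ * A)) := by
  have h : (A - B * (Bᴴ * A))ᴴ * (A - B * (Bᴴ * A)) = 1 - Aᴴ * B * Bᴴ * A := by
    simp only [Matrix.conjTranspose_sub, Matrix.conjTranspose_mul,
      Matrix.conjTranspose_conjTranspose, Matrix.sub_mul, Matrix.mul_sub, hA]
    have h1 : Aᴴ * B * Bᴴ * (B * (Bᴴ * A)) = Aᴴ * B * (Bᴴ * B) * (Bᴴ * A) := by
      simp only [Matrix.mul_assoc]
    rw [h1, hB, Matrix.mul_one]
    simp only [Matrix.mul_assoc]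
    abel
  rw [frobSq_eq_trace, h, Matrix.trace_sub, Matrix.trace_one, chordalDistSq]
  simp

theorem chordalDistSq_comm (A B : Channel M) : chordalDistSq A B = chordalDistSq B A := by
  rw [chordalDistSq, chordalDistSq, Matrix.mul_assoc, Matrix.trace_mul_comm, Matrix.mul_assoc,
    Matrix.mul_assoc, ← Matrix.mul_assoc Bᴴ, Matrix.trace_mul_comm, ← Matrix.mul_assoc]

/-- On ker Aᴴ only the component of B' orthogonal to the range of A' matters, and its size is the
chordal distance. Passing from B' to B = B' R costs the size of R = B'ᴴ B, hence the factor `frobSq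
B`. -/
theorem feedback1_le_chordalDistSq (hP : 0 ≤ P) {A B A' B' : Channel M} (hA : IsGenerator A' A)
    (hB : IsGenerator B' B) :
    feedback1 P A B ≤ (1 + P / M * (M * frobSq B * chordalDistSq A' B')) ^ M := by
  refine feedback1_le hP fun x hx => ?_
  obtain ⟨S, hS⟩ := exists_eq_mul_of_range_le hA.2.le
  obtain ⟨R, hR⟩ := exists_eq_mul_of_range_le hB.2.ge
  have hx' : A'ᴴ *ᵥ x = 0 := by
    rw [hS, Matrix.conjTranspose_mul, ← Matrix.mulVec_mulVec, hx, Matrix.mulVec_zero]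
  have hR' : R = B'ᴴ * B := by rw [hR, ← Matrix.mul_assoc, hB.1, Matrix.one_mul]
  have h1 : B'ᴴ *ᵥ x = (B' - A' * (A'ᴴ * B'))ᴴ *ᵥ x := by
    rw [Matrix.conjTranspose_sub, Matrix.sub_mulVec, Matrix.conjTranspose_mul,
      ← Matrix.mulVec_mulVec, hx', Matrix.mulVec_zero, sub_zero]
  have h2 : ∑ i, ‖(B'ᴴ *ᵥ x) i‖ ^ 2 ≤ chordalDistSq A' B' * ∑ i, ‖x i‖ ^ 2 := by
    rw [chordalDistSq_comm, chordalDistSq_eq_frobSq hB.1 hA.1, h1, ← frobSq_conjTranspose]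
    exact sum_norm_sq_mulVec_le _ x
  have h3 : frobSq Rᴴ ≤ M * frobSq B := by
    rw [frobSq_conjTranspose, hR']
    refine (frobSq_mul_le _ _).trans_eq ?_
    rw [frobSq_conjTranspose, frobSq_of_isometry hB.1, Fintype.card_fin]
  calc ∑ i, ‖(Bᴴ *ᵥ x) i‖ ^ 2 = ∑ i, ‖(Rᴴ *ᵥ (B'ᴴ *ᵥ x)) i‖ ^ 2 := by
        rw [Matrix.mulVec_mulVec, ← Matrix.conjTranspose_mul, ← hR]
    _ ≤ frobSq Rᴴ * ∑ i, ‖(B'ᴴ *ᵥ x) i‖ ^ 2 := sum_norm_sq_mulVec_le _ _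
    _ ≤ (M * frobSq B) * (chordalDistSq A' B' * ∑ i, ‖x i‖ ^ 2) :=
        mul_le_mul h3 h2 (Finset.sum_nonneg fun _ _ => sq_nonneg _) ((frobSq_nonneg _).trans h3)
    _ = _ := by ring

/-- The reference channel `[I; 0]`. -/
def refChannel (M : ℕ) : Channel M := Matrix.of fun r c => if (r : ℕ) = c then 1 else 0

theorem refChannel_isometry : (refChannel M)ᴴ * refChannel M = 1 := by
  ext i j
  rw [Matrix.mul_apply, Finset.sum_eq_single (⟨j, by omega⟩ : Fin (2 * M))]
  · simp [refChannel, Matrix.one_apply, Fin.ext_iff, eq_comm]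
  · intro b _ hb
    have : (b : ℕ) ≠ j := fun h => hb (Fin.ext h)
    simp [refChannel, this]
  · simp

/-- The projection 1 - B' B'ᴴ kills B, so the residual of A' = A S is that of (A - B) S. Closeness
of A to the reference channel keeps A well conditioned and thereby bounds S. -/
theorem chordalDistSq_le {A B A' B' : Channel M} (hA : IsGenerator A' A) (hB : IsGenerator B' B)
    (h : frobSq (A - refChannel M) ≤ 1 / 4) :
    chordalDistSq A' B' ≤ (4 * M + 2 * M ^ 2) * (frobSq (A - B) * (4 * M)) := by
  obtain ⟨S, hS⟩ := exists_eq_mul_of_range_le hA.2.le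
  obtain ⟨R, hR⟩ := exists_eq_mul_of_range_le hB.2.ge
  have hSle : frobSq S ≤ 4 * M := by
    have h1 : (refChannel M) * S = A' - (A - refChannel M) * S := by
      rw [hS, Matrix.sub_mul]; abel
    have h2 : frobSq S = frobSq (refChannel M * S) := by
      rw [frobSq_eq_trace, frobSq_eq_trace, Matrix.conjTranspose_mul, Matrix.mul_assoc,
        ← Matrix.mul_assoc _ _ S, refChannel_isometry, Matrix.one_mul]
    -- The threshold 1/4 yields `frobSq S` ≤ 2M + `frobSq S` / 2, and the last term is absorbed.
    have h3 := frobSq_sub_le A' ((A - refChannel M) * S)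
    rw [← h1, ← h2, frobSq_of_isometry hA.1, Fintype.card_fin] at h3
    have h4 := frobSq_mul_le (A - refChannel M) S
    nlinarith [frobSq_nonneg S]
  have h5 : A' - B' * (B'ᴴ * A') = (1 - B' * B'ᴴ) * ((A - B) * S) := by
    have h6 : (1 - B' * B'ᴴ) * B = 0 := by
      rw [hR, ← Matrix.mul_assoc, Matrix.sub_mul, Matrix.mul_assoc B', hB.1, Matrix.one_mul,
        Matrix.mul_one, sub_self, Matrix.zero_mul]
    have h7 : (1 - B' * B'ᴴ) * ((A - B) * S) = (1 - B' * B'ᴴ) * A' := by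
      rw [Matrix.sub_mul A, Matrix.mul_sub, ← Matrix.mul_assoc _ B, h6, Matrix.zero_mul, sub_zero,
        ← hS]
    rw [h7, Matrix.sub_mul, Matrix.one_mul, Matrix.mul_assoc]
  have h8 : frobSq (1 - B' * B'ᴴ) ≤ 4 * M + 2 * M ^ 2 := by
    have h9 := frobSq_sub_le 1 (B' * B'ᴴ)
    have h10 := frobSq_mul_le B' B'ᴴ
    have h11 : frobSq (1 : Matrix (Fin (2 * M)) (Fin (2 * M)) ℂ) = 2 * M := by
      rw [frobSq_of_isometry (by simp)]; simp
    rw [frobSq_conjTranspose, frobSq_of_isometry hB.1, Fintype.card_fin] at h10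
    rw [h11] at h9
    nlinarith
  rw [chordalDistSq_eq_frobSq hA.1 hB.1, h5]
  have h12 := frobSq_nonneg (A - B)
  calc frobSq ((1 - B' * B'ᴴ) * ((A - B) * S))
      ≤ frobSq (1 - B' * B'ᴴ) * (frobSq (A - B) * frobSq S) :=
        (frobSq_mul_le _ _).trans
          (mul_le_mul_of_nonneg_left (frobSq_mul_le _ _) (frobSq_nonneg _))
    _ ≤ _ := by
        refine mul_le_mul h8 (mul_le_mul_of_nonneg_left hSle h12) ?_ (by positivity)
        exact mul_nonneg h12 (frobSq_nonneg S)

end OIA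

/-! ### Gaussian matrices: characteristic function, unitary invariance, full rank. -/

namespace OIA

open scoped ComplexOrder ENNReal

instance isGaussian_complexGaussian : IsGaussian complexGaussian :=
  isGaussian_map_equiv (μ := (gaussianReal 0 (1 / 2)).prod (gaussianReal 0 (1 / 2)))
    Complex.equivRealProdCLM.symm

theorem measurable_complex_mk : Measurable (fun p : ℝ × ℝ => (⟨p.1, p.2⟩ : ℂ)) :=
  Complex.equivRealProdCLM.symm.continuous.measurable

theorem complexGaussian_absolutelyContinuous : complexGaussian ≪ volume := by
  have h1 : gaussianReal 0 (1 / 2) ≪ volume := gaussianReal_absolutelyContinuous 0 (by norm_num)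
  have h2 := (h1.prod h1).map Complex.measurableEquivRealProd.symm.measurable
  have h3 := Complex.volume_preserving_equiv_real_prod.symm.map_eq
  rw [← Measure.volume_eq_prod, h3] at h2
  exact h2

theorem integral_cexp_complexGaussian (t : ℂ) :
    ∫ z, Complex.exp (((star t * z).re : ℂ) * Complex.I) ∂complexGaussian =
      Complex.exp ((-(‖t‖ ^ 2 / 4) : ℝ) : ℂ) := by
  have hc (a : ℝ) : ∫ x : ℝ, Complex.exp (a * x * Complex.I) ∂(gaussianReal 0 (1 / 2)) =
      Complex.exp ((-(a ^ 2 / 4) : ℝ) : ℂ) := by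
    rw [← charFun_apply_real, charFun_gaussianReal]
    congr 1
    push_cast
    ring
  rw [complexGaussian, integral_map measurable_complex_mk.aemeasurable
    (Continuous.aestronglyMeasurable (by fun_prop))]
  have h (p : ℝ × ℝ) : Complex.exp (((star t * (⟨p.1, p.2⟩ : ℂ)).re : ℂ) * Complex.I) =
      Complex.exp (t.re * p.1 * Complex.I) * Complex.exp (t.im * p.2 * Complex.I) := by
    rw [← Complex.exp_add]
    congr 1
    simp
    ring
  simp_rw [h]
  rw [integral_prod_mul (fun x : ℝ => Complex.exp (t.re * x * Complex.I))
    (fun y : ℝ => Complex.exp (t.im * y * Complex.I)), hc, hc, ← Complex.exp_add]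
  congr 1
  rw [← Complex.normSq_eq_norm_sq, Complex.normSq_apply]
  push_cast
  ring

/-- The law of an `m × n` matrix with i.i.d. `CN(0, 1)` entries. -/
noncomputable def gaussMat (m n : ℕ) : Measure (Matrix (Fin m) (Fin n) ℂ) :=
  (Measure.pi fun _ => Measure.pi fun _ => complexGaussian : Measure (Fin m → Fin n → ℂ))

instance (m n : ℕ) : IsProbabilityMeasure (gaussMat m n) :=
  inferInstanceAs (IsProbabilityMeasure
    (Measure.pi fun _ => Measure.pi fun _ => complexGaussian : Measure (Fin m → Fin n → ℂ)))

instance (m n : ℕ) : BorelSpace (Matrix (Fin m) (Fin n) ℂ) :=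
  inferInstanceAs (BorelSpace (Fin m → Fin n → ℂ))

instance (m n : ℕ) : SecondCountableTopology (Matrix (Fin m) (Fin n) ℂ) :=
  inferInstanceAs (SecondCountableTopology (Fin m → Fin n → ℂ))

/-- The characteristic function depends on T only through its Frobenius norm, which is the source of
unitary invariance. -/
theorem integral_cexp_gaussMat {m n : ℕ} (T : Matrix (Fin m) (Fin n) ℂ) :
    ∫ X, Complex.exp (((∑ i, ∑ j, (star (T i j) * X i j).re : ℝ) : ℂ) * Complex.I) ∂gaussMat m n =
      Complex.exp ((-(frobSq T / 4) : ℝ) : ℂ) := by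
  have h (X : Fin m → Fin n → ℂ) :
      Complex.exp (((∑ i, ∑ j, (star (T i j) * X i j).re : ℝ) : ℂ) * Complex.I) =
      ∏ i, ∏ j, Complex.exp (((star (T i j) * X i j).re : ℂ) * Complex.I) := by
    simp_rw [← Complex.exp_sum]
    congr 1
    push_cast
    simp_rw [Finset.sum_mul]
  have h1 : ∫ X : Fin m → Fin n → ℂ,
      ∏ i, ∏ j, Complex.exp (((star (T i j) * X i j).re : ℂ) * Complex.I)
        ∂(Measure.pi fun _ => Measure.pi fun _ => complexGaussian) =
      Complex.exp ((-(frobSq T / 4) : ℝ) : ℂ) := by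
    have h2 (i : Fin m) : ∫ x : Fin n → ℂ,
        ∏ j, Complex.exp (((star (T i j) * x j).re : ℂ) * Complex.I)
          ∂(Measure.pi fun _ => complexGaussian) =
        ∏ j, Complex.exp ((-(‖T i j‖ ^ 2 / 4) : ℝ) : ℂ) := by
      rw [integral_fintype_prod_eq_prod (fun j (z : ℂ) =>
        Complex.exp (((star (T i j) * z).re : ℂ) * Complex.I))]
      exact Finset.prod_congr rfl fun j _ => integral_cexp_complexGaussian _
    rw [integral_fintype_prod_eq_prod (fun i (x : Fin n → ℂ) =>
      ∏ j, Complex.exp (((star (T i j) * x j).re : ℂ) * Complex.I)),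
      Finset.prod_congr rfl fun i _ => h2 i]
    simp_rw [← Complex.exp_sum, ← Complex.ofReal_sum]
    congr 2
    simp only [frobSq, Finset.sum_neg_distrib, Finset.sum_div]
  rw [← h1]
  exact integral_congr_ae (Eventually.of_forall h)

/-- The real pairing of complex matrices. -/
noncomputable def rePairing (m n : ℕ) :
    (Fin m → Fin n → ℂ) →ₗ[ℝ] (Fin m → Fin n → ℂ) →ₗ[ℝ] ℝ :=
  LinearMap.mk₂ ℝ (fun X T => ∑ i, ∑ j, (star (T i j) * X i j).re)
    (fun X Y T => by simp only [Pi.add_apply, mul_add, Complex.add_re, Finset.sum_add_distrib])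
    (fun c X T => by
      simp only [Pi.smul_apply, mul_smul_comm, Complex.smul_re, smul_eq_mul, Finset.mul_sum])
    (fun X S T => by
      simp only [Pi.add_apply, star_add, add_mul, Complex.add_re, Finset.sum_add_distrib])
    (fun c X T => by
      simp only [Pi.smul_apply, star_smul, star_trivial, smul_mul_assoc, Complex.smul_re,
        smul_eq_mul, Finset.mul_sum])

theorem ext_of_integral_cexp_eq {m n : ℕ} {μ ν : Measure (Matrix (Fin m) (Fin n) ℂ)}
    [hμ : IsFiniteMeasure μ] [hν : IsFiniteMeasure ν]
    (h : ∀ T : Matrix (Fin m) (Fin n) ℂ,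
      ∫ X, Complex.exp (((∑ i, ∑ j, (star (T i j) * X i j).re : ℝ) : ℂ) * Complex.I) ∂μ =
      ∫ X, Complex.exp (((∑ i, ∑ j, (star (T i j) * X i j).re : ℝ) : ℂ) * Complex.I) ∂ν) :
    μ = ν := by
  refine @ext_of_integral_char_eq (Fin m → Fin n → ℂ) _ _ _ Real.probChar (Fin m → Fin n → ℂ)
    _ _ _ _ _ _ _ (rePairing m n) Real.continuous_probChar Real.probChar_ne_one ?_ ?_ μ ν hμ hν
    fun T => ?_
  · intro X hX h0
    apply hX
    have h1 : ∑ i, ∑ j, ‖X i j‖ ^ 2 = 0 := by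
      have h2 := LinearMap.congr_fun h0 X
      simp only [rePairing, LinearMap.mk₂_apply, LinearMap.zero_apply] at h2
      rw [← h2]
      refine Finset.sum_congr rfl fun i _ => Finset.sum_congr rfl fun j _ => ?_
      rw [RCLike.star_def, Complex.conj_mul']
      norm_cast
    funext i j
    have h3 := (Finset.sum_eq_zero_iff_of_nonneg
      fun i _ => Finset.sum_nonneg fun j _ => sq_nonneg ‖X i j‖).1 h1 i (Finset.mem_univ _)
    have h4 := (Finset.sum_eq_zero_iff_of_nonneg fun j _ => sq_nonneg ‖X i j‖).1 h3 j
      (Finset.mem_univ _)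
    simpa using h4
  · simp only [rePairing, LinearMap.mk₂_apply]
    fun_prop
  · exact h T

/-- Unitary invariance: a semi-unitary transform of a Gaussian matrix is a Gaussian matrix. -/
theorem map_mul_gaussMat {m n p : ℕ} {F : Matrix (Fin p) (Fin m) ℂ} (hF : F * Fᴴ = 1) :
    (gaussMat m n).map (fun X => F * X) = gaussMat p n := by
  have hm : Measurable (fun X : Matrix (Fin m) (Fin n) ℂ => F * X) :=
    Continuous.measurable (by fun_prop)
  have := Measure.isProbabilityMeasure_map (μ := gaussMat m n) hm.aemeasurable
  refine ext_of_integral_cexp_eq fun T => ?_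
  rw [integral_map hm.aemeasurable (Continuous.aestronglyMeasurable (by fun_prop)),
    integral_cexp_gaussMat]
  -- F moves to the other side of the trace pairing as Fᴴ, and Fᴴ T has the Frobenius norm of T
  -- because F Fᴴ = 1.
  have h1 (X : Matrix (Fin m) (Fin n) ℂ) : ∑ i, ∑ j, (star (T i j) * (F * X) i j).re =
      ∑ i, ∑ j, (star ((Fᴴ * T) i j) * X i j).re := by
    have h2 {q : ℕ} (S Y : Matrix (Fin q) (Fin n) ℂ) :
        ∑ i, ∑ j, (star (S i j) * Y i j).re = (Sᴴ * Y).trace.re := by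
      rw [Finset.sum_comm]
      simp [Matrix.trace, Matrix.mul_apply]
    rw [h2, h2, Matrix.conjTranspose_mul, Matrix.conjTranspose_conjTranspose, Matrix.mul_assoc]
  simp_rw [h1]
  rw [integral_cexp_gaussMat, frobSq_eq_trace, frobSq_eq_trace, Matrix.conjTranspose_mul,
    Matrix.conjTranspose_conjTranspose, Matrix.mul_assoc, ← Matrix.mul_assoc F, hF, Matrix.one_mul]

theorem absolutelyContinuous_pi {α : Type*} [MeasurableSpace α] {μ ν : Measure α} [SigmaFinite μ]
    [SigmaFinite ν] (h : μ ≪ ν) (n : ℕ) :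
    (Measure.pi fun _ : Fin n => μ) ≪ Measure.pi fun _ : Fin n => ν := by
  induction n with
  | zero => rw [Measure.pi_of_empty, Measure.pi_of_empty]
  | succ n ih =>
    have h1 := (h.prod ih).map (MeasurableEquiv.piFinSuccAbove (fun _ => α) 0).symm.measurable
    rw [(measurePreserving_piFinSuccAbove (fun _ : Fin (n + 1) => μ) 0).symm.map_eq,
      (measurePreserving_piFinSuccAbove (fun _ : Fin (n + 1) => ν) 0).symm.map_eq] at h1
    exact h1

theorem gaussMat_absolutelyContinuous (m n : ℕ) :
    gaussMat m n ≪ (volume : Measure (Fin m → Fin n → ℂ)) :=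
  absolutelyContinuous_pi (absolutelyContinuous_pi complexGaussian_absolutelyContinuous n) m

/-- It suffices that the top M × M block is invertible. Along each line in the direction of the
reference channel its determinant is a characteristic polynomial, monic and so with finitely many
roots; hence the exceptional set is Lebesgue null, and the Gaussian law is absolutely continuous. -/
theorem ae_posDef_gram (M : ℕ) : ∀ᵐ X ∂gaussMat (2 * M) M, (Xᴴ * X).PosDef := by
  let s : Set (Fin (2 * M) → Fin M → ℂ) := {X | ((refChannel M)ᴴ * Matrix.of X).det ≠ 0}
  have hcont : Continuous fun X : Fin (2 * M) → Fin M → ℂ =>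
      ((refChannel M)ᴴ * Matrix.of X).det :=
    Continuous.matrix_det (continuous_const.matrix_mul continuous_id)
  have hs : MeasurableSet s := (isOpen_ne_fun hcont continuous_const).measurableSet
  let L : ℝ →ₗ[ℝ] (Fin (2 * M) → Fin M → ℂ) :=
    LinearMap.toSpanSingleton ℝ (Fin (2 * M) → Fin M → ℂ) (fun r c => refChannel M r c)
  have hae : ∀ᵐ X ∂(volume : Measure (Fin (2 * M) → Fin M → ℂ)), X ∈ s := by
    have : (volume : Measure (Fin (2 * M) → Fin M → ℂ)).IsAddHaarMeasure :=
      Measure.pi.isAddHaarMeasure _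
    refine ae_mem_of_ae_add_linearMap_mem L volume volume hs fun X => ?_
    let Y : Matrix (Fin M) (Fin M) ℂ := -((refChannel M)ᴴ * Matrix.of X)
    have hfin : {t : ℝ | Y.charpoly.eval (t : ℂ) = 0}.Finite := by
      refine Set.Finite.preimage (f := fun t : ℝ => (t : ℂ))
        (Complex.ofReal_injective.injOn) (s := {z | Y.charpoly.IsRoot z}) ?_
      exact Polynomial.finite_setOfPred_isRoot Y.charpoly_monic.ne_zero
    have h0 : ∀ᵐ t : ℝ, t ∉ {t : ℝ | Y.charpoly.eval (t : ℂ) = 0} :=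
      hfin.countable.ae_notMem volume
    filter_upwards [h0] with t ht
    have h1 : (refChannel M)ᴴ * Matrix.of (X + L t) = Matrix.scalar _ (t : ℂ) - Y := by
      have h2 : Matrix.of (X + L t) = Matrix.of X + (t : ℂ) • refChannel M := by
        ext r c
        simp [L]
      rw [h2, Matrix.mul_add, Matrix.mul_smul, refChannel_isometry]
      simp only [Y, sub_neg_eq_add, Matrix.scalar_apply, Matrix.smul_one_eq_diagonal, add_comm]
    change ((refChannel M)ᴴ * Matrix.of (X + L t)).det ≠ 0
    rw [h1, ← Matrix.eval_charpoly]
    exact ht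
  have hae' : ∀ᵐ X ∂gaussMat (2 * M) M, X ∈ s := gaussMat_absolutelyContinuous _ _ hae
  filter_upwards [hae'] with X hX
  refine Matrix.PosDef.conjTranspose_mul_self X ?_
  intro v w hvw
  have h3 : ((refChannel M)ᴴ * X) *ᵥ v = ((refChannel M)ᴴ * X) *ᵥ w := by
    rw [← Matrix.mulVec_mulVec, ← Matrix.mulVec_mulVec]
    exact congrArg _ hvw
  exact Matrix.mulVec_injective_of_isUnit
    ((Matrix.isUnit_iff_isUnit_det _).2 (isUnit_iff_ne_zero.2 hX)) h3

end OIA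

/-! ### Small-ball and tail estimates, integrability of the point-to-point rate. -/

namespace OIA

open scoped ComplexOrder ENNReal

/-- The interval lies in [-1, 2], where the centred density is at least its value at 2. -/
theorem exists_le_gaussianReal_Icc : ∃ κ : ℝ, 0 < κ ∧ ∀ a δ : ℝ, 0 ≤ a → a ≤ 1 → 0 ≤ δ → δ ≤ 1 →
    ENNReal.ofReal (κ * δ) ≤ gaussianReal 0 (1 / 2) (Set.Icc (a - δ) (a + δ)) := by
  have hpos : 0 < gaussianPDFReal 0 (1 / 2) 2 := gaussianPDFReal_pos _ _ _ (by norm_num)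
  refine ⟨2 * gaussianPDFReal 0 (1 / 2) 2, by positivity, fun a δ ha0 ha1 hδ0 hδ1 => ?_⟩
  rw [gaussianReal_apply _ (by norm_num)]
  calc ENNReal.ofReal (2 * gaussianPDFReal 0 (1 / 2) 2 * δ)
      = ∫⁻ _ in Set.Icc (a - δ) (a + δ), gaussianPDF 0 (1 / 2) 2 := by
        rw [setLIntegral_const, Real.volume_Icc, gaussianPDF, ← ENNReal.ofReal_mul hpos.le]
        congr 1
        ring
    _ ≤ _ := by
        refine setLIntegral_mono (measurable_gaussianPDF _ _) fun x hx => ?_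
        refine ENNReal.ofReal_le_ofReal ?_
        simp only [gaussianPDFReal_def, sub_zero]
        have hx2 : x ^ 2 ≤ 2 ^ 2 := by
          refine sq_le_sq' ?_ ?_ <;> linarith [hx.1, hx.2]
        gcongr

/-- The closed box of half-width `δ` centred at `a`. -/
def box (a δ : ℝ) : Set ℂ := {z | |z.re - a| ≤ δ ∧ |z.im| ≤ δ}

theorem measurableSet_box (a δ : ℝ) : MeasurableSet (box a δ) :=
  (measurableSet_le (f := fun z : ℂ => |z.re - a|) (by fun_prop) measurable_const).inter
    (measurableSet_le (f := fun z : ℂ => |z.im|) (by fun_prop) measurable_const)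

theorem norm_sub_le_of_mem_box {a δ : ℝ} {z : ℂ} (hz : z ∈ box a δ) : ‖z - a‖ ≤ 2 * δ := by
  refine (Complex.norm_le_abs_re_add_abs_im _).trans ?_
  have h1 := hz.1
  have h2 := hz.2
  simp only [Complex.sub_re, Complex.ofReal_re, Complex.sub_im, Complex.ofReal_im, sub_zero]
  linarith

theorem exists_le_complexGaussian_box : ∃ κ : ℝ, 0 < κ ∧ ∀ a δ : ℝ, 0 ≤ a → a ≤ 1 → 0 ≤ δ → δ ≤ 1 →
    ENNReal.ofReal (κ * δ ^ 2) ≤ complexGaussian (box a δ) := by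
  obtain ⟨κ, hκ, h⟩ := exists_le_gaussianReal_Icc
  refine ⟨κ ^ 2, by positivity, fun a δ ha0 ha1 hδ0 hδ1 => ?_⟩
  have h1 : (fun p : ℝ × ℝ => (⟨p.1, p.2⟩ : ℂ)) ⁻¹' box a δ =
      Set.Icc (a - δ) (a + δ) ×ˢ Set.Icc (0 - δ) (0 + δ) := by
    ext p
    simp only [box, Set.mem_preimage, Set.mem_ofPred_eq, Set.mem_prod, Set.mem_Icc, abs_le]
    constructor
    · rintro ⟨⟨h1, h2⟩, h3, h4⟩
      exact ⟨⟨by linarith, by linarith⟩, by linarith, by linarith⟩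
    · rintro ⟨⟨h1, h2⟩, h3, h4⟩
      exact ⟨⟨by linarith, by linarith⟩, by linarith, by linarith⟩
  rw [complexGaussian, Measure.map_apply measurable_complex_mk (measurableSet_box a δ), h1,
    Measure.prod_prod]
  calc ENNReal.ofReal (κ ^ 2 * δ ^ 2) = ENNReal.ofReal (κ * δ) * ENNReal.ofReal (κ * δ) := by
        rw [← ENNReal.ofReal_mul (by positivity)]
        congr 1
        ring
    _ ≤ _ := mul_le_mul' (h a δ ha0 ha1 hδ0 hδ1) (h 0 δ le_rfl zero_le_one hδ0 hδ1)

/-- The channels whose entries are `δ`-close to those of `[I; 0]`. -/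
def nearRef (M : ℕ) (δ : ℝ) : Set (Channel M) :=
  Set.univ.pi fun r : Fin (2 * M) => Set.univ.pi fun c : Fin M =>
    box (if (r : ℕ) = c then 1 else 0) δ

theorem measurableSet_nearRef (M : ℕ) (δ : ℝ) : MeasurableSet (nearRef M δ) :=
  MeasurableSet.univ_pi fun _ => MeasurableSet.univ_pi fun _ => measurableSet_box _ _

theorem norm_sub_refChannel_le {M : ℕ} {δ : ℝ} {A : Channel M} (hA : A ∈ nearRef M δ)
    (r : Fin (2 * M)) (c : Fin M) : ‖(A - refChannel M) r c‖ ≤ 2 * δ := by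
  have h := norm_sub_le_of_mem_box (hA r (Set.mem_univ _) c (Set.mem_univ _))
  rw [Matrix.sub_apply, refChannel, Matrix.of_apply]
  split_ifs at h ⊢ <;> simpa using h

theorem norm_sub_le_of_mem_nearRef {M : ℕ} {δ : ℝ} {A B : Channel M} (hA : A ∈ nearRef M δ)
    (hB : B ∈ nearRef M δ) (r : Fin (2 * M)) (c : Fin M) : ‖(A - B) r c‖ ≤ 4 * δ := by
  have h1 := norm_sub_refChannel_le hA r c
  have h2 := norm_sub_refChannel_le hB r c
  have h3 : (A - B) r c = (A - refChannel M) r c - (B - refChannel M) r c := by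
    simp [Matrix.sub_apply]
  rw [h3]
  linarith [norm_sub_le ((A - refChannel M) r c) ((B - refChannel M) r c)]

theorem exists_le_gaussMat_nearRef (M : ℕ) : ∃ κ : ℝ, 0 < κ ∧ ∀ δ : ℝ, 0 ≤ δ → δ ≤ 1 →
    ENNReal.ofReal ((κ * δ ^ 2) ^ (2 * M * M)) ≤ gaussMat (2 * M) M (nearRef M δ) := by
  obtain ⟨κ, hκ, h⟩ := exists_le_complexGaussian_box
  refine ⟨κ, hκ, fun δ hδ0 hδ1 => ?_⟩
  have h1 : gaussMat (2 * M) M (nearRef M δ) =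
      ∏ r : Fin (2 * M), ∏ c : Fin M, complexGaussian (box (if (r : ℕ) = c then 1 else 0) δ) := by
    refine (Measure.pi_pi _ _).trans ?_
    exact Finset.prod_congr rfl fun r _ => Measure.pi_pi _ _
  rw [h1]
  calc ENNReal.ofReal ((κ * δ ^ 2) ^ (2 * M * M))
      = ∏ _r : Fin (2 * M), ∏ _c : Fin M, ENNReal.ofReal (κ * δ ^ 2) := by
        rw [ENNReal.ofReal_pow (by positivity)]
        simp [pow_mul']
    _ ≤ _ := by
        refine Finset.prod_le_prod' fun r _ => Finset.prod_le_prod' fun c _ => ?_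
        refine h _ δ ?_ ?_ hδ0 hδ1 <;> split_ifs <;> norm_num

theorem integrable_norm_pow_complexGaussian (q : ℕ) :
    Integrable (fun z : ℂ => ‖z‖ ^ q) complexGaussian := by
  have h := IsGaussian.memLp_id complexGaussian (q : ℝ≥0∞) (by simp)
  exact h.integrable_norm_pow'

/-- Markov's inequality for the q-th moment; q is left free so that the tail can later beat the
number of users. -/
theorem exists_complexGaussian_norm_le (q : ℕ) : ∃ C : ℝ, 0 ≤ C ∧ ∀ s : ℝ, 0 < s →
    complexGaussian {z | s < ‖z‖} ≤ ENNReal.ofReal (C / s ^ q) := by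
  refine ⟨∫ z, ‖z‖ ^ q ∂complexGaussian, integral_nonneg fun _ => by positivity, fun s hs => ?_⟩
  have h := mul_meas_ge_le_integral_of_nonneg (μ := complexGaussian) (f := fun z : ℂ => ‖z‖ ^ q)
    (Eventually.of_forall fun _ => by positivity) (integrable_norm_pow_complexGaussian q) (s ^ q)
  refine (measure_mono (t := {z : ℂ | s ^ q ≤ ‖z‖ ^ q}) fun z hz => ?_).trans ?_
  · exact pow_le_pow_left₀ hs.le (le_of_lt hz) q
  · rw [← ofReal_measureReal]
    refine ENNReal.ofReal_le_ofReal ?_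
    rw [le_div_iff₀ (by positivity), mul_comm]
    exact h

theorem measurePreserving_entry {m n : ℕ} (r : Fin m) (c : Fin n) :
    MeasurePreserving (fun X : Matrix (Fin m) (Fin n) ℂ => X r c) (gaussMat m n) complexGaussian :=
  (measurePreserving_eval (fun _ : Fin n => complexGaussian) c).comp
    (measurePreserving_eval (fun _ : Fin m => Measure.pi fun _ : Fin n => complexGaussian) r)

theorem measurableSet_lt_norm (s : ℝ) : MeasurableSet {z : ℂ | s < ‖z‖} :=
  measurableSet_lt measurable_const measurable_norm

theorem exists_gaussMat_entry_norm_le (m n q : ℕ) : ∃ C : ℝ, 0 ≤ C ∧ ∀ s : ℝ, 0 < s →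
    gaussMat m n {X | ∃ r c, s < ‖X r c‖} ≤ ENNReal.ofReal (C / s ^ q) := by
  obtain ⟨C, hC0, hC⟩ := exists_complexGaussian_norm_le q
  refine ⟨m * n * C, by positivity, fun s hs => ?_⟩
  have h1 : {X : Matrix (Fin m) (Fin n) ℂ | ∃ r c, s < ‖X r c‖} =
      ⋃ r, ⋃ c, (fun X : Matrix (Fin m) (Fin n) ℂ => X r c) ⁻¹' {z | s < ‖z‖} := by
    ext X; simp
  rw [h1]
  calc _ ≤ ∑ _r : Fin m, ∑ _c : Fin n, ENNReal.ofReal (C / s ^ q) := by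
        refine (measure_iUnion_fintype_le _ _).trans (Finset.sum_le_sum fun r _ => ?_)
        refine (measure_iUnion_fintype_le _ _).trans (Finset.sum_le_sum fun c _ => ?_)
        rw [(measurePreserving_entry r c).measure_preimage
          (measurableSet_lt_norm s).nullMeasurableSet]
        exact hC s hs
    _ = _ := by
        simp only [Finset.sum_const, Finset.card_univ, Fintype.card_fin, nsmul_eq_mul]
        rw [← mul_assoc, mul_div_assoc, ENNReal.ofReal_mul (by positivity),
          ENNReal.ofReal_mul (by positivity), ENNReal.ofReal_natCast, ENNReal.ofReal_natCast]

theorem continuous_pointToPointRate_det {M : ℕ} (P : ℝ) :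
    Continuous fun X : Matrix (Fin M) (Fin M) ℂ =>
      (Matrix.det (1 + ((P / M : ℝ) : ℂ) • (X * Xᴴ))).re :=
  Complex.continuous_re.comp (Continuous.matrix_det (by fun_prop))

theorem measurable_pointToPointRate {M : ℕ} (P : ℝ) :
    Measurable fun X : Matrix (Fin M) (Fin M) ℂ => pointToPointRate P X := by
  have h := (continuous_pointToPointRate_det (M := M) P).measurable
  exact (Real.measurable_log.comp h).div_const _

theorem integrable_pointToPointRate {M : ℕ} {P : ℝ} (hP : 0 ≤ P) :
    Integrable (fun X => pointToPointRate P X) (gaussMat M M) := by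
  have h1 : Integrable (fun X : Matrix (Fin M) (Fin M) ℂ =>
      P / M * (∑ i, ∑ j, ‖X i j‖ ^ 2) / Real.log 2) (gaussMat M M) := by
    refine Integrable.div_const (Integrable.const_mul (integrable_finsetSum _ fun i _ =>
      integrable_finsetSum _ fun j _ => ?_) _) _
    exact (measurePreserving_entry i j).integrable_comp_of_integrable
      (integrable_norm_pow_complexGaussian 2)
  refine h1.mono' (measurable_pointToPointRate P).aestronglyMeasurable
    (Eventually.of_forall fun X => ?_)
  rw [Real.norm_of_nonneg (pointToPointRate_nonneg hP X)]
  exact pointToPointRate_le hP X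

end OIA

/-! ### The feedback value of the selected user tends to 1 in probability. -/

namespace OIA

open scoped ComplexOrder ENNReal

variable {M : ℕ} {P : ℝ}

/-- The law of the pair of interfering channels of one user. -/
noncomputable abbrev pairLaw (M : ℕ) : Measure (Channel M × Channel M) :=
  (gaussMat (2 * M) M).prod (gaussMat (2 * M) M)

/-- The law of the interfering channels of `K + 1` users. -/
noncomputable abbrev interferenceLaw (M K : ℕ) : Measure (Fin (K + 1) → Channel M × Channel M) :=
  Measure.pi fun _ => pairLaw M

theorem frobSq_sub_le_of_mem_nearRef {δ : ℝ} {A B : Channel M} (hA : A ∈ nearRef M δ)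
    (hB : B ∈ nearRef M δ) : frobSq (A - B) ≤ 32 * M ^ 2 * δ ^ 2 := by
  refine (frobSq_le_of_norm_le (norm_sub_le_of_mem_nearRef hA hB)).trans_eq ?_
  simp only [Fintype.card_fin]
  push_cast
  ring

/-- A selected user sees almost aligned interference as soon as some user has nearly identical
interfering channels and no user has a large interfering channel. -/
theorem exists_feedback1_selected_le (hP : 0 ≤ P) {sel : Selection M}
    (hsel : IsOIA1Selection P sel ∨ IsOIA2Selection sel) :
    ∃ C : ℝ, 0 ≤ C ∧ ∀ x : ℝ, 1 ≤ x → 32 * (M : ℝ) ^ 2 ≤ x ^ 4 → ∀ K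
      (G : Fin (K + 1) → Channel M × Channel M),
      (∀ k, ((G k).1ᴴ * (G k).1).PosDef ∧ ((G k).2ᴴ * (G k).2).PosDef) →
      (∃ k, (G k).1 ∈ nearRef M (x ^ 2)⁻¹ ∧ (G k).2 ∈ nearRef M (x ^ 2)⁻¹) →
      (∀ k r c, ‖(G k).2 r c‖ ≤ x) →
      feedback1 P (G (sel K G)).1 (G (sel K G)).2 ≤ (1 + C / x ^ 2) ^ M := by
  have hc : 0 ≤ P / M := div_nonneg hP (Nat.cast_nonneg M)
  rcases hsel with hsel | hsel
  · refine ⟨P / M * (32 * M ^ 2), by positivity, fun x hx _ K G _ ⟨k, hk1, hk2⟩ _ => ?_⟩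
    refine (hsel.minimal K G k).trans ((feedback1_le_frobSq_sub hP _ _).trans ?_)
    have h1 := frobSq_sub_le_of_mem_nearRef hk2 hk1
    -- Decay is given away here so that both schemes share the form C / x².
    have h2 : ((x ^ 2)⁻¹) ^ 2 ≤ (x ^ 2)⁻¹ :=
      pow_le_of_le_one (by positivity) (inv_le_one_of_one_le₀ (one_le_pow₀ hx)) two_ne_zero
    have h3 : frobSq ((G k).2 - (G k).1) ≤ 32 * M ^ 2 * (x ^ 2)⁻¹ :=
      h1.trans (by gcongr)
    have h4 := frobSq_nonneg ((G k).2 - (G k).1)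
    rw [mul_div_assoc, div_eq_mul_inv (32 * (M : ℝ) ^ 2)]
    gcongr
  · refine ⟨P / M * (M * (2 * M ^ 2) * ((4 * M + 2 * M ^ 2) * (32 * M ^ 2 * (4 * M)))),
      by positivity, fun x hx hxM K G hG ⟨k, hk1, hk2⟩ hb => ?_⟩
    have hx0 : 0 < x := by linarith
    choose T₁ hT₁ using fun k => exists_isGenerator (hG k).1
    choose T₂ hT₂ using fun k => exists_isGenerator (hG k).2
    have h1 := hsel.minimal K G (fun k => (T₁ k, T₂ k)) (fun k => ⟨hT₁ k, hT₂ k⟩) k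
    have h2 : frobSq ((G k).1 - refChannel M) ≤ 1 / 4 := by
      refine (frobSq_le_of_norm_le (norm_sub_refChannel_le hk1)).trans ?_
      simp only [Fintype.card_fin]
      push_cast
      have h3 : 2 * (M : ℝ) * M * (2 * (x ^ 2)⁻¹) ^ 2 = 32 * M ^ 2 / x ^ 4 * (1 / 4) := by
        field_simp
        ring
      rw [h3]
      have h4 : 32 * (M : ℝ) ^ 2 / x ^ 4 ≤ 1 := by
        rw [div_le_one (by positivity)]
        exact hxM
      linarith
    have h3 := chordalDistSq_le (hT₁ k) (hT₂ k) h2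
    have h4 := frobSq_sub_le_of_mem_nearRef hk1 hk2
    have h5 : chordalDistSq (T₁ (sel K G)) (T₂ (sel K G)) ≤
        (4 * M + 2 * M ^ 2) * (32 * M ^ 2 * ((x ^ 2)⁻¹) ^ 2 * (4 * M)) :=
      h1.trans (h3.trans (by gcongr))
    have h6 : frobSq (G (sel K G)).2 ≤ 2 * M ^ 2 * x ^ 2 := by
      refine (frobSq_le_of_norm_le (hb (sel K G))).trans_eq ?_
      simp only [Fintype.card_fin]
      push_cast
      ring
    have h7 : 0 ≤ chordalDistSq (T₁ (sel K G)) (T₂ (sel K G)) := by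
      rw [chordalDistSq_eq_frobSq (hT₁ _).1 (hT₂ _).1]
      exact frobSq_nonneg _
    have h8 := frobSq_nonneg (G (sel K G)).2
    refine (feedback1_le_chordalDistSq hP (hT₁ (sel K G)) (hT₂ (sel K G))).trans ?_
    -- The squared channel size, of order x², meets a squared chordal distance of order x⁻⁴.
    have h9 : P / M * (M * frobSq (G (sel K G)).2 *
        chordalDistSq (T₁ (sel K G)) (T₂ (sel K G))) ≤
        P / M * (M * (2 * M ^ 2 * x ^ 2) *
          ((4 * M + 2 * M ^ 2) * (32 * M ^ 2 * ((x ^ 2)⁻¹) ^ 2 * (4 * M)))) := by gcongr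
    have h10 : P / M * (M * (2 * M ^ 2 * x ^ 2) *
          ((4 * M + 2 * M ^ 2) * (32 * M ^ 2 * ((x ^ 2)⁻¹) ^ 2 * (4 * M)))) =
        P / M * (M * (2 * M ^ 2) * ((4 * M + 2 * M ^ 2) * (32 * M ^ 2 * (4 * M)))) / x ^ 2 := by
      generalize P / M = c
      field_simp
    rw [← h10]
    gcongr

theorem ae_posDef_interferenceLaw (M K : ℕ) : ∀ᵐ G ∂interferenceLaw M K,
    ∀ k, ((G k).1ᴴ * (G k).1).PosDef ∧ ((G k).2ᴴ * (G k).2).PosDef := by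
  rw [ae_all_iff]
  intro k
  have h := measurePreserving_eval (fun _ : Fin (K + 1) => pairLaw M) k
  have h1 := (measurePreserving_fst.comp h).quasiMeasurePreserving.ae (ae_posDef_gram M)
  have h2 := (measurePreserving_snd.comp h).quasiMeasurePreserving.ae (ae_posDef_gram M)
  filter_upwards [h1, h2] with G hG1 hG2
  exact ⟨hG1, hG2⟩

/-- By independence this is (1 - p)^(K+1) ≤ exp(-(K+1)p). The 4M² complex entries of a pair each
contribute a factor of order δ² to p. -/
theorem exists_interferenceLaw_forall_notMem_le (M : ℕ) : ∃ κ : ℝ, 0 < κ ∧ ∀ δ : ℝ, 0 ≤ δ →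
    δ ≤ 1 → ∀ K, interferenceLaw M K {G | ∀ k, ¬ ((G k).1 ∈ nearRef M δ ∧ (G k).2 ∈ nearRef M δ)} ≤
      ENNReal.ofReal (Real.exp (-((K + 1) * (κ * δ ^ (8 * M * M))))) := by
  obtain ⟨κ, hκ, h⟩ := exists_le_gaussMat_nearRef M
  refine ⟨κ ^ (4 * M * M), by positivity, fun δ hδ0 hδ1 K => ?_⟩
  have hN := measurableSet_nearRef M δ
  have h1 : {G : Fin (K + 1) → Channel M × Channel M |
      ∀ k, ¬ ((G k).1 ∈ nearRef M δ ∧ (G k).2 ∈ nearRef M δ)} =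
      Set.univ.pi fun _ => (nearRef M δ ×ˢ nearRef M δ)ᶜ := by
    ext G
    simp [Set.mem_pi]
  have h2 : κ ^ (4 * M * M) * δ ^ (8 * M * M) ≤ (pairLaw M).real (nearRef M δ ×ˢ nearRef M δ) := by
    have h3 := h δ hδ0 hδ1
    rw [← ofReal_measureReal, ENNReal.ofReal_le_ofReal_iff measureReal_nonneg] at h3
    rw [measureReal_prod_prod]
    calc κ ^ (4 * M * M) * δ ^ (8 * M * M)
        = (κ * δ ^ 2) ^ (2 * M * M) * (κ * δ ^ 2) ^ (2 * M * M) := by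
          rw [← pow_add, mul_pow, ← pow_mul]
          ring_nf
      _ ≤ _ := mul_le_mul h3 h3 (by positivity) measureReal_nonneg
  rw [h1, Measure.pi_pi, Finset.prod_const, Finset.card_univ, Fintype.card_fin,
    ← ofReal_measureReal, ← ENNReal.ofReal_pow measureReal_nonneg,
    probReal_compl_eq_one_sub (hN.prod hN)]
  refine ENNReal.ofReal_le_ofReal ?_
  have h4 : 0 ≤ 1 - (pairLaw M).real (nearRef M δ ×ˢ nearRef M δ) := by
    linarith [measureReal_le_one (μ := pairLaw M) (s := nearRef M δ ×ˢ nearRef M δ)]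
  calc _ ≤ (Real.exp (-(κ ^ (4 * M * M) * δ ^ (8 * M * M)))) ^ (K + 1) := by
        gcongr
        linarith [Real.one_sub_le_exp_neg (κ ^ (4 * M * M) * δ ^ (8 * M * M))]
    _ = _ := by
        rw [← Real.exp_nat_mul]
        push_cast
        ring_nf

theorem exists_interferenceLaw_exists_lt_norm_le (M q : ℕ) : ∃ C : ℝ, 0 ≤ C ∧ ∀ s : ℝ, 0 < s →
    ∀ K, interferenceLaw M K {G | ∃ k r c, s < ‖(G k).2 r c‖} ≤
      ENNReal.ofReal ((K + 1) * (C / s ^ q)) := by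
  obtain ⟨C, hC0, hC⟩ := exists_gaussMat_entry_norm_le (2 * M) M q
  refine ⟨C, hC0, fun s hs K => ?_⟩
  let S : Set (Channel M) := {X | ∃ r c, s < ‖X r c‖}
  have hS : MeasurableSet S := by
    have h0 : S = ⋃ r, ⋃ c, (fun X : Channel M => X r c) ⁻¹' {z | s < ‖z‖} := by
      ext X; simp [S]
    rw [h0]
    exact MeasurableSet.iUnion fun r => MeasurableSet.iUnion fun c =>
      (measurePreserving_entry r c).measurable (measurableSet_lt_norm s)
  have h1 : {G : Fin (K + 1) → Channel M × Channel M | ∃ k r c, s < ‖(G k).2 r c‖} =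
      ⋃ k, (fun G : Fin (K + 1) → Channel M × Channel M => (G k).2) ⁻¹' S := by
    ext G; simp [S]
  rw [h1]
  calc _ ≤ ∑ _k : Fin (K + 1), ENNReal.ofReal (C / s ^ q) := by
        refine (measure_iUnion_fintype_le _ _).trans (Finset.sum_le_sum fun k _ => ?_)
        have h2 := measurePreserving_snd.comp
          (measurePreserving_eval (fun _ : Fin (K + 1) => pairLaw M) k)
        exact (h2.measure_preimage hS.nullMeasurableSet).trans_le (hC s hs)
    _ = _ := by
        rw [Finset.sum_const, Finset.card_univ, Fintype.card_fin, nsmul_eq_mul,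
          ENNReal.ofReal_mul (by positivity)]
        congr 1
        rw [← Nat.cast_succ, ENNReal.ofReal_natCast]

/-- With x^(2n) = K + 1 and δ = x⁻², the probability that no user is near the reference is at most
exp(-κ xⁿ), and that some entry exceeds x is at most C'/x. -/
theorem tendsto_feedback1_selected (hM : 0 < M) (hP : 0 ≤ P) {sel : Selection M}
    (hsel : IsOIA1Selection P sel ∨ IsOIA2Selection sel) {b : ℝ} (hb : 1 < b) :
    Tendsto (fun K => interferenceLaw M K
      {G | b < feedback1 P (G (sel K G)).1 (G (sel K G)).2}) atTop (𝓝 0) := by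
  obtain ⟨C, hC0, hC⟩ := exists_feedback1_selected_le hP hsel
  obtain ⟨κ, hκ, hnear⟩ := exists_interferenceLaw_forall_notMem_le M
  -- Chosen so that δ^(8M²) = x⁻ⁿ, which leaves (K + 1) x⁻ⁿ = xⁿ.
  set n : ℕ := 16 * M * M with hn
  have hn0 : n ≠ 0 := by positivity
  -- One moment more than 2n: the union bound over K + 1 = x^(2n) users then still leaves a factor
  -- 1/x.
  obtain ⟨C', hC'0, htail⟩ := exists_interferenceLaw_exists_lt_norm_le M (2 * n + 1)
  let x : ℕ → ℝ := fun K => ((K : ℝ) + 1) ^ ((1 : ℝ) / ((2 * n : ℕ) : ℝ))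
  have hxpow (K : ℕ) : x K ^ (2 * n) = K + 1 := by
    simp only [x, one_div]
    exact Real.rpow_inv_natCast_pow (by positivity) (by positivity)
  have hx : Tendsto x atTop atTop := by
    refine (tendsto_rpow_atTop (by positivity)).comp ?_
    exact tendsto_atTop_add_const_right _ _ tendsto_natCast_atTop_atTop
  have hlim : Tendsto (fun y : ℝ => (1 + C / y ^ 2) ^ M) atTop (𝓝 1) := by
    have h : Tendsto (fun y : ℝ => C / y ^ 2) atTop (𝓝 0) :=
      (tendsto_pow_atTop two_ne_zero).const_div_atTop C
    simpa using (h.const_add 1).pow M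
  have hbound : ∀ᶠ K in atTop, interferenceLaw M K
      {G | b < feedback1 P (G (sel K G)).1 (G (sel K G)).2} ≤
      ENNReal.ofReal (Real.exp (-(κ * x K ^ n))) + ENNReal.ofReal (C' / x K) := by
    filter_upwards [hx.eventually_ge_atTop 1, hx.eventually (hlim.eventually_lt_const hb),
      hx.eventually ((tendsto_pow_atTop (α := ℝ) four_ne_zero).eventually_ge_atTop
        (32 * (M : ℝ) ^ 2))] with K h1 h2 h3
    have hx0 : 0 < x K := by linarith
    have hsub : {G : Fin (K + 1) → Channel M × Channel M |
        b < feedback1 P (G (sel K G)).1 (G (sel K G)).2} ⊆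
        {G | ¬ ∀ k, ((G k).1ᴴ * (G k).1).PosDef ∧ ((G k).2ᴴ * (G k).2).PosDef} ∪
        ({G | ∀ k, ¬ ((G k).1 ∈ nearRef M (x K ^ 2)⁻¹ ∧ (G k).2 ∈ nearRef M (x K ^ 2)⁻¹)} ∪
        {G | ∃ k r c, x K < ‖(G k).2 r c‖}) := by
      intro G hG
      by_contra hcon
      simp only [Set.mem_union, Set.mem_ofPred_eq, not_or, not_not] at hcon
      obtain ⟨hc1, hc2, hc3⟩ := hcon
      push Not at hc2 hc3
      have := hC (x K) h1 h3 K G hc1 hc2 hc3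
      have hG' : b < feedback1 P (G (sel K G)).1 (G (sel K G)).2 := hG
      linarith
    refine (measure_mono hsub).trans ((measure_union_le _ _).trans ?_)
    have hzero : interferenceLaw M K
        {G | ¬ ∀ k, ((G k).1ᴴ * (G k).1).PosDef ∧ ((G k).2ᴴ * (G k).2).PosDef} = 0 :=
      ae_iff.1 (ae_posDef_interferenceLaw M K)
    rw [hzero, zero_add]
    refine (measure_union_le _ _).trans (add_le_add ?_ ?_)
    · have h4 := hnear (x K ^ 2)⁻¹ (by positivity) (inv_le_one_of_one_le₀ (one_le_pow₀ h1)) K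
      refine h4.trans_eq ?_
      congr 3
      rw [← hxpow, inv_pow, ← pow_mul, two_mul n, pow_add]
      have h5 : 2 * (8 * M * M) = n := by rw [hn]; ring
      rw [h5]
      field_simp
    · refine (htail (x K) hx0 K).trans_eq ?_
      congr 1
      rw [← hxpow, pow_succ]
      field_simp
  refine tendsto_of_tendsto_of_tendsto_of_le_of_le' tendsto_const_nhds ?_
    (Eventually.of_forall fun _ => zero_le) hbound
  have h1 : Tendsto (fun K => Real.exp (-(κ * x K ^ n))) atTop (𝓝 0) :=
    Real.tendsto_exp_neg_atTop_nhds_zero.comp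
      (((tendsto_pow_atTop hn0).comp hx).const_mul_atTop hκ)
  have h2 : Tendsto (fun K => C' / x K) atTop (𝓝 0) := hx.const_div_atTop C'
  simpa using (ENNReal.tendsto_ofReal h1).add (ENNReal.tendsto_ofReal h2)

end OIA

/-! ### Joint law of the channels and the selected user. -/

namespace OIA

open scoped ComplexOrder ENNReal

variable {M : ℕ} {P : ℝ}

/-- The joint law of the interfering channels and the desired channels of `K + 1` users. -/
noncomputable abbrev channelLaw (M K : ℕ) :
    Measure ((Fin (K + 1) → Channel M × Channel M) × (Fin (K + 1) → Channel M)) :=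
  (interferenceLaw M K).prod (Measure.pi fun _ => gaussMat (2 * M) M)

/-- All entries of the channels of `K + 1` users, as a family of complex numbers. -/
def entries (K : ℕ) (Z : (Fin (K + 1) → Channel M × Channel M) × (Fin (K + 1) → Channel M)) :
    Fin (K + 1) × Fin 3 × Fin (2 * M) × Fin M → ℂ :=
  fun j => ![Z.2 j.1, (Z.1 j.1).1, (Z.1 j.1).2] j.2.1 j.2.2.1 j.2.2.2

/-- The channels of `K + 1` users with given entries. -/
def ofEntries (K : ℕ) (z : Fin (K + 1) × Fin 3 × Fin (2 * M) × Fin M → ℂ) :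
    (Fin (K + 1) → Channel M × Channel M) × (Fin (K + 1) → Channel M) :=
  (fun k => (Matrix.of fun r c => z (k, 1, r, c), Matrix.of fun r c => z (k, 2, r, c)),
    fun k => Matrix.of fun r c => z (k, 0, r, c))

theorem measurable_entry {m n : ℕ} (r : Fin m) (c : Fin n) :
    Measurable fun X : Matrix (Fin m) (Fin n) ℂ => X r c :=
  (measurePreserving_entry r c).measurable

theorem measurable_matrix {α : Type*} [MeasurableSpace α] {m n : ℕ}
    {f : α → Matrix (Fin m) (Fin n) ℂ} (hf : ∀ r c, Measurable fun a => f a r c) :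
    Measurable f :=
  measurable_pi_lambda _ fun r => measurable_pi_lambda _ fun c => hf r c

theorem measurable_ofEntries (K : ℕ) : Measurable (ofEntries (M := M) K) := by
  refine Measurable.prodMk ?_ ?_
  · refine measurable_pi_lambda _ fun k => Measurable.prodMk ?_ ?_
    · exact measurable_matrix fun r c => measurable_pi_apply (k, 1, r, c)
    · exact measurable_matrix fun r c => measurable_pi_apply (k, 2, r, c)
  · refine measurable_pi_lambda _ fun k => ?_
    exact measurable_matrix fun r c => measurable_pi_apply (k, 0, r, c)

theorem measurable_entries (K : ℕ) : Measurable (entries (M := M) K) := by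
  refine measurable_pi_lambda _ fun ⟨k, i, r, c⟩ => ?_
  fin_cases i
  · exact (measurable_entry r c).comp ((measurable_pi_apply k).comp measurable_snd)
  · exact (measurable_entry r c).comp
      (measurable_fst.comp ((measurable_pi_apply k).comp measurable_fst))
  · exact (measurable_entry r c).comp
      (measurable_snd.comp ((measurable_pi_apply k).comp measurable_fst))

theorem gaussMat_univ_pi {m n : ℕ} (s : Fin m → Fin n → Set ℂ) :
    gaussMat m n (Set.univ.pi fun r => Set.univ.pi fun c => s r c) =
      ∏ r, ∏ c, complexGaussian (s r c) :=
  (Measure.pi_pi _ _).trans (Finset.prod_congr rfl fun _ _ => Measure.pi_pi _ _)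

theorem map_entries_channelLaw (M K : ℕ) :
    (channelLaw M K).map (entries K) = Measure.pi fun _ => complexGaussian := by
  refine (Measure.pi_eq fun s hs => ?_).symm
  let S (k : Fin (K + 1)) (i : Fin 3) : Set (Channel M) :=
    Set.univ.pi fun r => Set.univ.pi fun c => s (k, i, r, c)
  have h1 : entries K ⁻¹' Set.univ.pi s =
      (Set.univ.pi fun k => S k 1 ×ˢ S k 2) ×ˢ (Set.univ.pi fun k => S k 0) := by
    ext Z
    simp only [S, Set.mem_preimage, Set.mem_univ_pi, Set.mem_prod, Prod.forall]
    constructor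
    · intro h
      exact ⟨fun k => ⟨fun r _ c _ => h k 1 r c, fun r _ c _ => h k 2 r c⟩,
        fun k _ r _ c _ => h k 0 r c⟩
    · rintro ⟨h12, h0⟩ k i r c
      fin_cases i
      · exact h0 k trivial r trivial c trivial
      · exact (h12 k).1 r trivial c trivial
      · exact (h12 k).2 r trivial c trivial
  rw [Measure.map_apply (measurable_entries K) (MeasurableSet.univ_pi hs), h1, Measure.prod_prod,
    Measure.pi_pi, Measure.pi_pi]
  simp_rw [Measure.prod_prod, S, gaussMat_univ_pi, Fintype.prod_prod_type, Fin.prod_univ_three]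
  rw [← Finset.prod_mul_distrib]
  refine Finset.prod_congr rfl fun k _ => ?_
  ring

theorem IsGaussianChannel.hasLaw_channels {Ω : Type*} [MeasurableSpace Ω] {μ : Measure Ω}
    {H : ℕ → Fin 3 → Ω → Channel M} (hH : IsGaussianChannel μ H) (K : ℕ) :
    HasLaw (fun ω => ((fun k : Fin (K + 1) => (H k 1 ω, H k 2 ω)), fun k : Fin (K + 1) => H k 0 ω))
      (channelLaw M K) μ := by
  let X : Ω → Fin (K + 1) × Fin 3 × Fin (2 * M) × Fin M → ℂ :=
    fun ω j => H j.1 j.2.1 ω j.2.2.1 j.2.2.2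
  have hX : AEMeasurable X μ := aemeasurable_pi_lambda _ fun j =>
    (hH.hasLaw j.1 j.2.1 j.2.2.1 j.2.2.2).aemeasurable
  have hmap : μ.map X = Measure.pi fun _ => complexGaussian := by
    have hinj : Function.Injective
        fun j : Fin (K + 1) × Fin 3 × Fin (2 * M) × Fin M => (((j.1 : ℕ), j.2) :
          ℕ × Fin 3 × Fin (2 * M) × Fin M) := by
      rintro ⟨k, j⟩ ⟨k', j'⟩ h
      simp only [Prod.mk.injEq] at h
      exact Prod.ext (Fin.ext h.1) h.2
    have h := (hH.indep.precomp hinj).map_fun_eq_pi_map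
      fun j : Fin (K + 1) × Fin 3 × Fin (2 * M) × Fin M =>
      (hH.hasLaw j.1 j.2.1 j.2.2.1 j.2.2.2).aemeasurable
    refine h.trans ?_
    congr 1
    funext j
    exact (hH.hasLaw j.1 j.2.1 j.2.2.1 j.2.2.2).map_eq
  have hcomp : (fun ω => ((fun k : Fin (K + 1) => (H k 1 ω, H k 2 ω)),
      fun k : Fin (K + 1) => H k 0 ω)) = ofEntries K ∘ X := rfl
  refine ⟨hcomp ▸ (measurable_ofEntries K).comp_aemeasurable hX, ?_⟩
  rw [hcomp, ← AEMeasurable.map_map_of_aemeasurable (measurable_ofEntries K).aemeasurable hX, hmap,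
    ← map_entries_channelLaw, Measure.map_map (measurable_ofEntries K) (measurable_entries K)]
  -- `ofEntries K` after `entries K` is the identity by definition.
  exact Measure.map_id

section SelectedUser

variable (P : ℝ) (F : ℕ → Channel M → Channel M → Post M) (sel : Selection M) (K : ℕ)

/-- The postprocessing matrix of the selected user. -/
def selectedPost (G : Fin (K + 1) → Channel M × Channel M) : Post M :=
  F (sel K G) (G (sel K G)).1 (G (sel K G)).2

/-- The rate loss of the selected user. -/
noncomputable def selectedLoss (G : Fin (K + 1) → Channel M × Channel M) : ℝ :=
  rateLoss P (selectedPost F sel K G) (G (sel K G)).1 (G (sel K G)).2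

/-- The rate of the selected user as a function of the channels. -/
noncomputable def rateOfChannels
    (Z : (Fin (K + 1) → Channel M × Channel M) × (Fin (K + 1) → Channel M)) : ℝ :=
  rate P (selectedPost F sel K Z.1) (Z.2 (sel K Z.1)) (Z.1 (sel K Z.1)).1 (Z.1 (sel K Z.1)).2

variable {P F sel}

theorem measurable_selected {α β : Type*} [MeasurableSpace α] [MeasurableSpace β]
    (hsel : Measurable (sel K)) {g : α → Fin (K + 1) → Channel M × Channel M} (hg : Measurable g)
    {f : Fin (K + 1) → α → β} (hf : ∀ k, Measurable (f k)) :
    Measurable fun a => f (sel K (g a)) a :=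
  (measurable_from_prod_countable_right (f := fun p : Fin (K + 1) × α => f p.1 p.2) hf).comp
    ((hsel.comp hg).prodMk measurable_id)

theorem measurable_selectedPost (hsel : Measurable (sel K)) (hF : IsOIAPostprocessing P F) :
    Measurable (selectedPost F sel K) :=
  measurable_selected K hsel measurable_id
    (f := fun (k : Fin (K + 1)) (G : Fin (K + 1) → Channel M × Channel M) =>
      F k (G k).1 (G k).2) fun k => (hF.measurable k).comp (measurable_pi_apply k)

theorem measurable_selectedPair (hsel : Measurable (sel K)) :
    Measurable fun G : Fin (K + 1) → Channel M × Channel M => G (sel K G) :=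
  measurable_selected K hsel measurable_id
    (f := fun (k : Fin (K + 1)) (G : Fin (K + 1) → Channel M × Channel M) => G k)
    fun k => measurable_pi_apply k

theorem measurable_selectedDesired (hsel : Measurable (sel K)) :
    Measurable fun Z : (Fin (K + 1) → Channel M × Channel M) × (Fin (K + 1) → Channel M) =>
      Z.2 (sel K Z.1) :=
  measurable_selected K hsel measurable_fst
    (f := fun (k : Fin (K + 1))
      (Z : (Fin (K + 1) → Channel M × Channel M) × (Fin (K + 1) → Channel M)) => Z.2 k)
    fun k => (measurable_pi_apply k).comp measurable_snd

theorem measurable_rateLoss {α : Type*} [MeasurableSpace α] (P : ℝ) {f : α → Post M}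
    {A B : α → Channel M} (hf : Measurable f) (hA : Measurable A) (hB : Measurable B) :
    Measurable fun x => rateLoss P (f x) (A x) (B x) := by
  have h : Continuous fun p : Post M × Channel M × Channel M =>
      (interferenceCov P p.1 p.2.1 p.2.2).det.re := by
    unfold interferenceCov
    exact Complex.continuous_re.comp (Continuous.matrix_det (by fun_prop))
  have h1 := h.measurable.comp (hf.prodMk (hA.prodMk hB))
  have h2 := (Real.measurable_log.comp h1).div_const (Real.log 2)
  exact h2

theorem measurable_rate {α : Type*} [MeasurableSpace α] (hP : 0 ≤ P) {f : α → Post M}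
    {D A B : α → Channel M} (hf : Measurable f) (hD : Measurable D) (hA : Measurable A)
    (hB : Measurable B) : Measurable fun x => rate P (f x) (D x) (A x) (B x) := by
  simp_rw [rate_eq_sub hP]
  have h : Continuous fun p : Post M × Channel M × Channel M × Channel M =>
      (interferenceCov P p.1 p.2.2.1 p.2.2.2 +
        ((P / M : ℝ) : ℂ) • ((p.1 * p.2.1) * (p.1 * p.2.1)ᴴ)).det.re := by
    unfold interferenceCov
    exact Complex.continuous_re.comp (Continuous.matrix_det (by fun_prop))
  have h1 := h.measurable.comp (hf.prodMk (hD.prodMk (hA.prodMk hB)))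
  have h2 := ((Real.measurable_log.comp h1).div_const (Real.log 2)).sub
    (measurable_rateLoss P hf hA hB)
  exact h2

theorem measurable_selectedLoss (hsel : Measurable (sel K)) (hF : IsOIAPostprocessing P F) :
    Measurable (selectedLoss P F sel K) :=
  measurable_rateLoss P (measurable_selectedPost K hsel hF)
    (measurable_selectedPair K hsel).fst (measurable_selectedPair K hsel).snd

theorem measurable_rateOfChannels (hP : 0 ≤ P) (hsel : Measurable (sel K))
    (hF : IsOIAPostprocessing P F) : Measurable (rateOfChannels P F sel K) :=
  measurable_rate hP ((measurable_selectedPost K hsel hF).comp measurable_fst)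
    (measurable_selectedDesired K hsel)
    ((measurable_selectedPair K hsel).comp measurable_fst).fst
    ((measurable_selectedPair K hsel).comp measurable_fst).snd

/-- The postprocessed desired channel of the selected user is an i.i.d. Gaussian matrix independent
of the interfering channels. -/
theorem measurePreserving_selected (hsel : Measurable (sel K)) (hF : IsOIAPostprocessing P F) :
    MeasurePreserving
      (fun Z : (Fin (K + 1) → Channel M × Channel M) × (Fin (K + 1) → Channel M) =>
        (Z.1, selectedPost F sel K Z.1 * Z.2 (sel K Z.1)))
      (channelLaw M K) ((interferenceLaw M K).prod (gaussMat M M)) := by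
  -- For fixed interference G the selected index and F are constants, so the fibre map is evaluation
  -- at one user followed by a fixed semi-unitary matrix.
  refine MeasurePreserving.skew_product (f := id)
    (g := fun G (D : Fin (K + 1) → Channel M) => selectedPost F sel K G * D (sel K G))
    (MeasurePreserving.id _) ?_ (Eventually.of_forall fun G => ?_)
  · have hmul : Measurable fun p : Post M × Channel M => p.1 * p.2 :=
      Continuous.measurable (by fun_prop)
    exact hmul.comp (((measurable_selectedPost K hsel hF).comp measurable_fst).prodMk
      (measurable_selectedDesired K hsel))
  · have h1 := measurePreserving_eval (fun _ : Fin (K + 1) => gaussMat (2 * M) M) (sel K G)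
    have hm : Measurable fun X : Channel M => selectedPost F sel K G * X :=
      Continuous.measurable (by fun_prop)
    have h2 := Measure.map_map (μ := Measure.pi fun _ : Fin (K + 1) => gaussMat (2 * M) M) hm
      h1.measurable
    have h3 : selectedPost F sel K G * (selectedPost F sel K G)ᴴ = 1 := hF.semiUnitary _ _ _
    rw [h1.map_eq, map_mul_gaussMat h3] at h2
    exact h2.symm

end SelectedUser

theorem integrable_snd_pointToPointRate (hP : 0 ≤ P) (K : ℕ) :
    Integrable (fun p : (Fin (K + 1) → Channel M × Channel M) × Matrix (Fin M) (Fin M) ℂ =>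
      pointToPointRate P p.2) ((interferenceLaw M K).prod (gaussMat M M)) :=
  measurePreserving_snd.integrable_comp_of_integrable (integrable_pointToPointRate hP)

/-! ### Bounds on the mean rate and the limit. -/

section Bounds

variable {F : ℕ → Channel M → Channel M → Post M} {sel : Selection M} (K : ℕ)

theorem integrable_rateOfChannels (hP : 0 ≤ P) (hsel : Measurable (sel K))
    (hF : IsOIAPostprocessing P F) : Integrable (rateOfChannels P F sel K) (channelLaw M K) := by
  refine ((measurePreserving_selected K hsel hF).integrable_comp_of_integrable
    (integrable_snd_pointToPointRate hP K)).mono'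
    (measurable_rateOfChannels K hP hsel hF).aestronglyMeasurable (Eventually.of_forall fun Z => ?_)
  rw [rateOfChannels, Real.norm_of_nonneg (rate_nonneg hP _ _ _ _)]
  exact rate_le_pointToPointRate hP _ _ _ _

theorem integral_rateOfChannels_le (hP : 0 ≤ P) (hsel : Measurable (sel K))
    (hF : IsOIAPostprocessing P F) :
    ∫ Z, rateOfChannels P F sel K Z ∂channelLaw M K ≤ ergodicCapacity M P := by
  have hmp := measurePreserving_selected K hsel hF
  have hInt := integrable_snd_pointToPointRate (M := M) hP K
  refine (integral_mono (integrable_rateOfChannels K hP hsel hF)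
    (hmp.integrable_comp_of_integrable hInt) fun Z =>
      rate_le_pointToPointRate hP _ _ _ _).trans_eq ?_
  have h1 := integral_map hmp.measurable.aemeasurable (hmp.map_eq ▸ hInt.aestronglyMeasurable)
  rw [hmp.map_eq] at h1
  refine h1.symm.trans ?_
  have h2 := integral_map measurable_snd.aemeasurable
    (μ := (interferenceLaw M K).prod (gaussMat M M)) (f := fun X => pointToPointRate P X)
    (measurable_pointToPointRate P).aestronglyMeasurable
  rw [measurePreserving_snd.map_eq] at h2
  exact h2.symm

/-- On the event of large loss the rate is only bounded below by 0. The event depends on the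
interference alone, hence is independent of F D, and the expectation factors. -/
theorem le_integral_rateOfChannels (hP : 0 ≤ P) (hsel : Measurable (sel K))
    (hF : IsOIAPostprocessing P F) {ε : ℝ} (hε : 0 ≤ ε) :
    (1 - (interferenceLaw M K).real {G | ε < selectedLoss P F sel K G}) * ergodicCapacity M P - ε ≤
      ∫ Z, rateOfChannels P F sel K Z ∂channelLaw M K := by
  have hmp := measurePreserving_selected K hsel hF
  let E : Set (Fin (K + 1) → Channel M × Channel M) := {G | ε < selectedLoss P F sel K G}
  have hE : MeasurableSet E := measurableSet_lt measurable_const (measurable_selectedLoss K hsel hF)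
  let f : (Fin (K + 1) → Channel M × Channel M) × Matrix (Fin M) (Fin M) ℂ → ℝ :=
    fun p => Eᶜ.indicator (fun _ => (1 : ℝ)) p.1 * pointToPointRate P p.2
  have hfint : Integrable f ((interferenceLaw M K).prod (gaussMat M M)) :=
    Integrable.mul_prod ((integrable_const (1 : ℝ)).indicator hE.compl)
      (integrable_pointToPointRate hP)
  have hfval : ∫ p, f p ∂(interferenceLaw M K).prod (gaussMat M M) =
      (1 - (interferenceLaw M K).real E) * ergodicCapacity M P := by
    rw [integral_prod_mul (Eᶜ.indicator fun _ => (1 : ℝ)) fun X => pointToPointRate P X,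
      integral_indicator_const _ hE.compl, probReal_compl_eq_one_sub hE, smul_eq_mul, mul_one]
    rfl
  have h1 := integral_map hmp.measurable.aemeasurable (hmp.map_eq ▸ hfint.aestronglyMeasurable)
  rw [hmp.map_eq, hfval] at h1
  have hle := integral_mono ((hmp.integrable_comp_of_integrable hfint).sub (integrable_const ε))
    (integrable_rateOfChannels K hP hsel hF) fun Z => ?_
  · rw [integral_sub' (hmp.integrable_comp_of_integrable hfint) (integrable_const ε)] at hle
    simp only [integral_const, probReal_univ, one_smul] at hle
    rw [h1]
    exact hle
  · have h2 := rate_nonneg hP (selectedPost F sel K Z.1) (Z.2 (sel K Z.1)) (Z.1 (sel K Z.1)).1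
      (Z.1 (sel K Z.1)).2
    have h3 := pointToPointRate_sub_rateLoss_le hP (selectedPost F sel K Z.1) (Z.2 (sel K Z.1))
      (Z.1 (sel K Z.1)).1 (Z.1 (sel K Z.1)).2
    simp only [Pi.sub_apply, Function.comp_apply, f]
    by_cases hZ : Z.1 ∈ E
    · rw [Set.indicator_of_notMem (by simpa using hZ), zero_mul, rateOfChannels]
      linarith
    · have h4 : selectedLoss P F sel K Z.1 ≤ ε := not_lt.1 hZ
      rw [selectedLoss] at h4
      rw [Set.indicator_of_mem (by simpa using hZ), one_mul, rateOfChannels]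
      linarith

end Bounds

theorem tendsto_selectedLoss (hM : 0 < M) (hP : 0 ≤ P)
    {F : ℕ → Channel M → Channel M → Post M} (hF : IsOIAPostprocessing P F) {sel : Selection M}
    (hsel : IsOIA1Selection P sel ∨ IsOIA2Selection sel) {ε : ℝ} (hε : 0 < ε) :
    Tendsto (fun K => (interferenceLaw M K).real {G | ε < selectedLoss P F sel K G})
      atTop (𝓝 0) := by
  have hb : 1 < (2 : ℝ) ^ ε := Real.one_lt_rpow one_lt_two hε
  have h1 : Tendsto (fun K => interferenceLaw M K {G | ε < selectedLoss P F sel K G})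
      atTop (𝓝 0) := by
    refine tendsto_of_tendsto_of_tendsto_of_le_of_le tendsto_const_nhds
      (tendsto_feedback1_selected hM hP hsel hb) (fun _ => zero_le)
      fun K => measure_mono fun G hG => ?_
    have h2 : ε < Real.logb 2 (feedback1 P (G (sel K G)).1 (G (sel K G)).2) :=
      lt_of_lt_of_le hG (hF.rateLoss_le _ _ _)
    have h3 := one_le_feedback1 hP (G (sel K G)).1 (G (sel K G)).2
    exact (Real.lt_logb_iff_rpow_lt one_lt_two (by linarith)).1 h2
  exact (ENNReal.tendsto_toReal ENNReal.zero_ne_top).comp h1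

/-- The upper bound holds for every K, so only the lower bound needs a limit; ε is half the gap to
the capacity. -/
theorem tendsto_integral_rateOfChannels (hM : 0 < M) (hP : 0 ≤ P)
    {F : ℕ → Channel M → Channel M → Post M} (hF : IsOIAPostprocessing P F) {sel : Selection M}
    (hsel : IsOIA1Selection P sel ∨ IsOIA2Selection sel) (hm : ∀ K, Measurable (sel K)) :
    Tendsto (fun K => ∫ Z, rateOfChannels P F sel K Z ∂channelLaw M K) atTop
      (𝓝 (ergodicCapacity M P)) := by
  refine tendsto_order.2 ⟨fun a ha => ?_, fun a ha => Eventually.of_forall fun K =>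
    (integral_rateOfChannels_le K hP (hm K) hF).trans_lt ha⟩
  obtain ⟨ε, hε, haε⟩ : ∃ ε : ℝ, 0 < ε ∧ a < ergodicCapacity M P - ε :=
    ⟨(ergodicCapacity M P - a) / 2, by linarith, by linarith⟩
  have h1 : Tendsto (fun K => (1 - (interferenceLaw M K).real {G | ε < selectedLoss P F sel K G}) *
      ergodicCapacity M P - ε) atTop (𝓝 ((1 - 0) * ergodicCapacity M P - ε)) :=
    (((tendsto_selectedLoss hM hP hF hsel hε).const_sub 1).mul_const _).sub_const ε
  rw [sub_zero, one_mul] at h1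
  filter_upwards [h1.eventually_const_lt haε] with K hK
  exact hK.trans_le (le_integral_rateOfChannels K hP (hm K) hF hε.le)

end OIA

theorem theorem1 {Ω : Type*} [MeasurableSpace Ω] (μ : Measure Ω) [IsProbabilityMeasure μ]
    (M : ℕ) (hM : 0 < M) (P : ℝ) (hP : 0 < P)
    (H : ℕ → Fin 3 → Ω → OIA.Channel M) (hH : OIA.IsGaussianChannel μ H)
    (F : ℕ → OIA.Channel M → OIA.Channel M → OIA.Post M) (hF : OIA.IsOIAPostprocessing P F)
    (sel : OIA.Selection M) (hsel : OIA.IsOIA1Selection P sel ∨ OIA.IsOIA2Selection sel) :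
    Integrable (fun G => OIA.pointToPointRate P (Matrix.of G)) (OIA.gaussianMatrix M) ∧
    (∀ K, Integrable (OIA.selectedRate P H F sel K) μ) ∧
    Tendsto (fun K => ∫ ω, OIA.selectedRate P H F sel K ω ∂μ) atTop
      (𝓝 (OIA.ergodicCapacity M P)) := by
  have hm : ∀ K, Measurable (sel K) := by
    rcases hsel with h | h
    · exact h.measurable
    · exact h.measurable
  have hInt (K : ℕ) := OIA.integrable_rateOfChannels K hP.le (hm K) hF
  have hmeas (K : ℕ) := OIA.measurable_rateOfChannels K hP.le (hm K) hF
  refine ⟨OIA.integrable_pointToPointRate hP.le, fun K => ?_, ?_⟩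
  · have hlaw := hH.hasLaw_channels K
    have h1 := hInt K
    rw [← hlaw.map_eq] at h1
    exact h1.comp_aemeasurable hlaw.aemeasurable
  · refine (OIA.tendsto_integral_rateOfChannels hM hP.le hF hsel hm).congr fun K => ?_
    have hlaw := hH.hasLaw_channels K
    rw [← hlaw.map_eq, integral_map hlaw.aemeasurable (hmeas K).aestronglyMeasurable]
    rfl
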